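/- **Setting.** Let $\mathbb S,\mathbb A$ be finite sets, $K\ge 1$, $\alpha_1,\dots,\alpha_K>0$, $N\ge1$. An $N$-armed weakly coupled MDP consists, for each arm $i\in[N]$, of transition probabilities $\mathbb P_i(s'\mid s,a)$, a reward function $r_i(s,a)$ and cost functions $c_{k,i}(s,a)\ge 0$, $k\in[K]$, on $\mathbb S\times\mathbb A$; there is an action $0\in\mathbb A$ with $c_{k,i}(s,0)=0$ for all $k,i,s$. Given the actions, the arms move independently. Let $|r_i(s,a)|\le r_{\max}$ and $c_{k,i}(s,a)\le c_{\max}$ for all $k,i,s,a$. For an initial system state $\bm S_0\in\mathbb S^N$ let $R^*(N,\bm S_0)$ be the supremum of $$R^-(\pi,\bm S_0)=\liminf_{T\to\infty}\frac1{TN}\sum_{t=0}^{T-1}\sum_{i\in[N]}\mathbb E[r_i(S^\pi_{i,t},A^\pi_{i,t})]$$ over all (history-dependent, randomized) policies $\pi$ that satisfy $\sum_{i\in[N]}c_{k,i}(S^\pi_{i,t},A^\pi_{i,t})\le\alpha_kN$ almost surely for all $k\in[K]$ and $t\ge 0$. **LP relaxation.** Let $y^*=(y_i^*(s,a))$ be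 any maximizer of $\frac1N\sum_{i,s,a}y_i(s,a)r_i(s,a)$ over all $y\ge 0$ with $\frac1N\sum_{i,s,a}y_i(s,a)c_{k,i}(s,a)\le\alpha_k$ for all $k$, $\sum_{s',a'}\mathbb P_i(s\mid s',a')y_i(s',a')=\sum_a y_i(s,a)$ for all $i,s$, and $\sum_{s,a}y_i(s,a)=1$ for all $i$. Put $\mu_i^*(s)=\sum_a y_i^*(s,a)$, let $\bar\pi_i^*(a\mid s)=y_i^*(s,a)/\mu_i^*(s)$ if $\mu_i^*(s)>0$ and $\bar\pi_i^*(a\mid s)=1/|\mathbb A|$ otherwise, and let $P_i(s,s')=\sum_a\mathbb P_i(s'\mid s,a)\bar\pi_i^*(a\mid s)$. **Assumption.** Every $P_i$ is an aperiodic unichain (exactly one recurrent class, possibly with transient states), and its mixing time $\tau_i=\max_s\min\{t\in\mathbb N:\|P_i^t(s,\cdot)-\mu_i^*\|_1\le 1/e\}$ satisfies $\tau_i\le\tau$, where $\tau>0$. **ID reassignment.** Let $C^*_{k,i}=\sum_{s,a}y_i^*(s,a)c_{k,i}(s,a)$, $\mathcal A=\{k:\sum_iC^*_{k,i}\ge\alpha_kN/2\}$,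 $\alpha_{\min}=\min_k\alpha_k$, $\delta=\alpha_{\min}/4$, $d=\lceil (c_{\max}-\delta)K/(\alpha_{\min}/2-\delta)\rceil$. If $\mathcal A=\emptyset$, every arm keeps its ID. Otherwise start with no arm having a new ID and $\mathcal D_k=\{i:C^*_{k,i}\ge\delta\}$. For $\ell=0,\dots,\lfloor N/d\rfloor-1$ in turn, let $\mathcal I(\ell)=\{\ell d+1,\dots,(\ell+1)d\}$, set $j=\ell d+1$, and go once through the $k\in\mathcal A$ (in any order): if $\sum C^*_{k,i}$ over the arms $i$ with new ID in $\mathcal I(\ell)$ is less than $\delta$, pick any $i\in\mathcal D_k$, give it the new ID $j$, remove it from all $\mathcal D_{k'}$, and increase $j$ by one. Finally the remaining arms receive the remaining IDs in $[N]$ in any way, one each. **ID policy.** At each time $t$ and in system state $(S_{i,t})_i$, sample independent ideal actions $\widehat A_{i,t}\sim\bar\pi_i^*(\cdot\mid S_{i,t})$. With the arms listed by their new IDs $1,\dots,N$, the arms with new IDs $1,2,\dots$ take their ideal actions as long as the total cost of the ideal actions of the arms up to and including the present one is at most $\alpha_kN$ for every $k$; from the first arm at which this fails on, all arms take action $0$.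 **Proposition.** There are constants $C_{\mathrm{ID}},C_{\mathrm{finite}}>0$ that depend only on $K,(\alpha_k)_k,r_{\max},c_{\max},\tau$ (in particular not on $N$) such that, in the setting and under the assumption above, for every $N\ge 1$, every optimal LP solution $y^*$, every outcome of the ID reassignment, every initial state $\bm S_0$ and every $T\ge1$, the ID policy $\pi$ satisfies $$R^*(N,\bm S_0)-\frac1{TN}\sum_{t=0}^{T-1}\sum_{i\in[N]}\mathbb E\bigl[r_i(S^\pi_{i,t},A^\pi_{i,t})\bigr]\le\frac{C_{\mathrm{ID}}}{\sqrt N}+\frac{C_{\mathrm{finite}}}{T}.$$ -/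

import Mathlib

open scoped ENNReal

universe u v

/-- The law of a vector with independent coordinates, the `i`-th one distributed as `p i`. -/
noncomputable def indepProd {N : ℕ} {β : Type*} [Fintype β] (p : Fin N → PMF β) :
    PMF (Fin N → β) :=
  PMF.ofFintype (fun x => ∏ i, p i (x i)) (by
    classical
    have h := Finset.prod_univ_sum (fun _ : Fin N => (Finset.univ : Finset β))
      (fun i b => p i b)
    rw [Fintype.piFinset_univ] at h
    rw [← h]
    refine Finset.prod_eq_one fun i _ => ?_
    have h1 := (p i).tsum_coe
    rwa [tsum_fintype] at h1)

/-! ### Finite Markov chains -/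

section MarkovChain

variable {S : Type*} [Fintype S] [DecidableEq S]

/-- `s'` can be reached from `s` (in zero or more steps). -/
def ChainReaches (P : Matrix S S ℝ) (s s' : S) : Prop := ∃ n : ℕ, 0 < (P ^ n) s s'

/-- Recurrence of a state of a finite chain: it can be reached back from wherever it leads. -/
def ChainRecurrent (P : Matrix S S ℝ) (s : S) : Prop :=
  ∀ s', ChainReaches P s s' → ChainReaches P s' s

/-- There is exactly one recurrent class (transient states are allowed). -/
def ChainUnichain (P : Matrix S S ℝ) : Prop :=
  (∃ s, ChainRecurrent P s) ∧
    ∀ s s', ChainRecurrent P s → ChainRecurrent P s' → ChainReaches P s s'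

/-- Every recurrent state has period one: the greatest common divisor of its possible return
times is one. -/
def ChainAperiodic (P : Matrix S S ℝ) : Prop :=
  ∀ s, ChainRecurrent P s →
    ∀ d : ℕ, (∀ n : ℕ, 0 < n → 0 < (P ^ n) s s → d ∣ n) → d = 1

/-- The mixing time `max_s min {t | ‖P^t(s, ·) - μ‖₁ ≤ 1/e}`; a minimum over the empty set is `∞`. -/
noncomputable def chainMixingTime (P : Matrix S S ℝ) (μ : S → ℝ) : ℕ∞ :=
  ⨆ s : S, ⨅ (t : ℕ) (_ : ∑ s', |(P ^ t) s s' - μ s'| ≤ 1 / Real.exp 1), (t : ℕ∞)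

end MarkovChain

/-! ### Weakly coupled Markov decision processes -/

/-- An `N`-armed weakly coupled MDP with arm state space `S`, arm action space `A` and `K` types of
costs. The arms are arbitrary (fully heterogeneous). Costs are nonnegative, and one action `idle`
(the action `0`) costs nothing, for every arm in every state. The budgets `α k * N` are kept
outside of the structure. -/
structure WCMDP (S A : Type*) (K N : ℕ) where
  /-- law of the next state of arm `i` in state `s` under action `a` -/
  trans : Fin N → S → A → PMF S
  reward : Fin N → S → A → ℝ
  cost : Fin K → Fin N → S → A → ℝ
  idle : A
  cost_nonneg : ∀ k i s a, 0 ≤ cost k i s a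
  cost_idle : ∀ k i s, cost k i s idle = 0

/-- A (history-dependent, randomized) policy: given the past state-action pairs of the system
(most recent first) and the present system state, the law of the system action. The time is the
length of the history. -/
abbrev SysPolicy (S A : Type*) (N : ℕ) :=
  List ((Fin N → S) × (Fin N → A)) → (Fin N → S) → PMF (Fin N → A)

namespace WCMDP

variable {S A : Type*} [Fintype S] [Fintype A] [DecidableEq S] {K N : ℕ}

/-- Given the actions, the arms move independently. -/
noncomputable def sysTrans (M : WCMDP S A K N) (s : Fin N → S) (a : Fin N → A) :
    PMF (Fin N → S) :=
  indepProd fun i => M.trans i (s i) (a i)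

/-- The joint law of the history before time `t` and of the system state at time `t`, under the
policy `π` from the initial system state `s₀`. -/
noncomputable def histLaw (M : WCMDP S A K N) (π : SysPolicy S A N) (s₀ : Fin N → S) :
    ℕ → PMF (List ((Fin N → S) × (Fin N → A)) × (Fin N → S))
  | 0 => PMF.pure ([], s₀)
  | t + 1 => (histLaw M π s₀ t).bind fun hs =>
      (π hs.1 hs.2).bind fun a =>
        (M.sysTrans hs.2 a).map fun s' => ((hs.2, a) :: hs.1, s')

/-- The joint law of the system state and the system action at time `t`. -/
noncomputable def stateActionLaw (M : WCMDP S A K N) (π : SysPolicy S A N) (s₀ : Fin N → S)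
    (t : ℕ) : PMF ((Fin N → S) × (Fin N → A)) :=
  (M.histLaw π s₀ t).bind fun hs => (π hs.1 hs.2).map fun a => (hs.2, a)

/-- The expected reward `𝔼[r_i(S_{i,t}, A_{i,t})]` of arm `i` at time `t`. -/
noncomputable def expReward (M : WCMDP S A K N) (π : SysPolicy S A N) (s₀ : Fin N → S)
    (t : ℕ) (i : Fin N) : ℝ :=
  ∑ x : (Fin N → S) × (Fin N → A),
    (M.stateActionLaw π s₀ t x).toReal * M.reward i (x.1 i) (x.2 i)

/-- The expected reward per arm, averaged over the first `T` steps. -/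
noncomputable def avgReward (M : WCMDP S A K N) (π : SysPolicy S A N) (s₀ : Fin N → S)
    (T : ℕ) : ℝ :=
  1 / ((T : ℝ) * (N : ℝ)) * ∑ t ∈ Finset.range T, ∑ i, M.expReward π s₀ t i

/-- The liminf average reward `R⁻(π, s₀)`. -/
noncomputable def liminfReward (M : WCMDP S A K N) (π : SysPolicy S A N) (s₀ : Fin N → S) : ℝ :=
  Filter.liminf (fun T => M.avgReward π s₀ T) Filter.atTop

/-- From the initial state `s₀`, the policy `π` almost surely satisfies all hard budget constraints
at all times. -/
def IsAdmissible (M : WCMDP S A K N) (α : Fin K → ℝ) (π : SysPolicy S A N)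
    (s₀ : Fin N → S) : Prop :=
  ∀ t : ℕ, ∀ x ∈ (M.stateActionLaw π s₀ t).support,
    ∀ k, ∑ i, M.cost k i (x.1 i) (x.2 i) ≤ α k * N

/-- The optimal value `R*(N, s₀)`. -/
noncomputable def optValue (M : WCMDP S A K N) (α : Fin K → ℝ) (s₀ : Fin N → S) : ℝ :=
  sSup {v : ℝ | ∃ π : SysPolicy S A N, M.IsAdmissible α π s₀ ∧ v = M.liminfReward π s₀}

/-! #### The linear programming relaxation and the optimal single-armed policies -/

/-- Feasibility of the state-action frequencies `y i s a` for the LP relaxation. -/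
structure IsLPFeasible (M : WCMDP S A K N) (α : Fin K → ℝ) (y : Fin N → S → A → ℝ) : Prop where
  budget : ∀ k, 1 / (N : ℝ) * ∑ i, ∑ s, ∑ a, y i s a * M.cost k i s a ≤ α k
  stationary : ∀ i s, ∑ s', ∑ a', (M.trans i s' a' s).toReal * y i s' a' = ∑ a, y i s a
  total : ∀ i, ∑ s, ∑ a, y i s a = 1
  nonneg : ∀ i s a, 0 ≤ y i s a

/-- The objective function of the LP relaxation. -/
noncomputable def lpObjective (M : WCMDP S A K N) (y : Fin N → S → A → ℝ) : ℝ :=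
  1 / (N : ℝ) * ∑ i, ∑ s, ∑ a, y i s a * M.reward i s a

/-- `y` is an optimal solution of the LP relaxation. -/
structure IsLPOptimal (M : WCMDP S A K N) (α : Fin K → ℝ) (y : Fin N → S → A → ℝ) : Prop where
  feasible : M.IsLPFeasible α y
  optimal : ∀ y', M.IsLPFeasible α y' → M.lpObjective y' ≤ M.lpObjective y

/-- The probability `π̄_i(a | s)` of the single-armed policy of arm `i` built from `y`. -/
noncomputable def singleArmProb (y : Fin N → S → A → ℝ) (i : Fin N) (s : S) (a : A) : ℝ :=
  if 0 < ∑ a', y i s a' then y i s a / ∑ a', y i s a' else 1 / (Fintype.card A : ℝ)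

/-- The single-armed policy of arm `i` in state `s`, as a law on actions. -/
noncomputable def singleArmPolicy [Nonempty A] (y : Fin N → S → A → ℝ)
    (hy : ∀ i s a, 0 ≤ y i s a) (i : Fin N) (s : S) : PMF A :=
  PMF.ofFintype (fun a => ENNReal.ofReal (singleArmProb y i s a)) (by
    have h0 : ∀ a, 0 ≤ singleArmProb y i s a := fun a => by
      unfold singleArmProb
      split_ifs with h
      · exact div_nonneg (hy i s a) h.le
      · positivity
    rw [← ENNReal.ofReal_sum_of_nonneg fun a _ => h0 a]
    unfold singleArmProb
    split_ifs with h
    · rw [← Finset.sum_div, div_self h.ne', ENNReal.ofReal_one]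
    · have : (Fintype.card A : ℝ) ≠ 0 := by exact_mod_cast Fintype.card_ne_zero
      simp [this])

/-- The transition matrix `P_i` of arm `i` under its single-armed policy. -/
noncomputable def inducedChain (M : WCMDP S A K N) (y : Fin N → S → A → ℝ) (i : Fin N) :
    Matrix S S ℝ :=
  Matrix.of fun s s' => ∑ a, (M.trans i s a s').toReal * singleArmProb y i s a

/-- The state distribution `μ_i(s) = ∑_a y_i(s, a)`. -/
noncomputable def stateDist (y : Fin N → S → A → ℝ) (i : Fin N) (s : S) : ℝ := ∑ a, y i s a

/-! #### ID reassignment -/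

/-- The expected cost `C_{k,i}` of type `k` of arm `i` under the frequencies `y`. -/
noncomputable def expCost (M : WCMDP S A K N) (y : Fin N → S → A → ℝ) (k : Fin K)
    (i : Fin N) : ℝ :=
  ∑ s, ∑ a, y i s a * M.cost k i s a

/-- The set of active constraints. -/
def activeSet (M : WCMDP S A K N) (α : Fin K → ℝ) (y : Fin N → S → A → ℝ) : Set (Fin K) :=
  {k | α k / 2 * N ≤ ∑ i, M.expCost y k i}

end WCMDP

/-- The threshold `δ = α_min / 4` of the reassignment algorithm. -/
noncomputable def reassignThreshold {K : ℕ} (α : Fin K → ℝ) : ℝ := (⨅ k, α k) / 4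

/-- The group size `d = ⌈(c_max - δ) K / (α_min / 2 - δ)⌉` of the reassignment algorithm. -/
noncomputable def reassignGroupSize {K : ℕ} (α : Fin K → ℝ) (cmax : ℝ) : ℕ :=
  ⌈(cmax - reassignThreshold α) * K / ((⨅ k, α k) / 2 - reassignThreshold α)⌉₊

/-- The variables of the reassignment algorithm: the partial map `newID` (new IDs are counted from
`0`; the set `F` of arms with a new ID is the domain of `newID`), the sets `cand k` of candidate
arms, and the next new ID `next` to be given out. -/
structure ReassignState (K N : ℕ) where
  newID : Fin N → Option ℕ
  cand : Fin K → Set (Fin N)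
  next : ℕ

namespace ReassignState

variable {K N : ℕ}

/-- The initial values: no arm has a new ID, and `cand k = {i | δ ≤ C k i}`. -/
def init (C : Fin K → Fin N → ℝ) (δ : ℝ) : ReassignState K N where
  newID := fun _ => none
  cand := fun k => {i | δ ≤ C k i}
  next := 0

open Classical in
/-- The total of `c i` over the arms `i` whose new ID lies in `{lo, …, hi - 1}`. -/
noncomputable def segmentSum (st : ReassignState K N) (c : Fin N → ℝ) (lo hi : ℕ) : ℝ :=
  ∑ i with ∃ p, st.newID i = some p ∧ lo ≤ p ∧ p < hi, c i

open Classical in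
/-- Give the new ID `next` to arm `i`, and remove `i` from all sets of candidates. -/
noncomputable def assign (st : ReassignState K N) (i : Fin N) : ReassignState K N where
  newID := Function.update st.newID i (some st.next)
  cand := fun k => st.cand k \ {i}
  next := st.next + 1

/-- One pass through the body of the inner loop, for the constraint `k` and the group
`{lo, …, hi - 1}` of new IDs. Any candidate may be picked. -/
inductive BodyStep (C : Fin K → Fin N → ℝ) (δ : ℝ) (lo hi : ℕ) (k : Fin K) :
    ReassignState K N → ReassignState K N → Prop
  | skip (st : ReassignState K N) (h : δ ≤ st.segmentSum (C k) lo hi) :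
      BodyStep C δ lo hi k st st
  | pick (st : ReassignState K N) (i : Fin N) (h : st.segmentSum (C k) lo hi < δ)
      (hmem : i ∈ st.cand k) : BodyStep C δ lo hi k st (st.assign i)

/-- The inner loop, over a list of constraints. -/
inductive InnerLoop (C : Fin K → Fin N → ℝ) (δ : ℝ) (lo hi : ℕ) :
    List (Fin K) → ReassignState K N → ReassignState K N → Prop
  | nil (st : ReassignState K N) : InnerLoop C δ lo hi [] st st
  | cons (k : Fin K) (ks : List (Fin K)) (st st₁ st₂ : ReassignState K N)
      (h₁ : BodyStep C δ lo hi k st st₁) (h₂ : InnerLoop C δ lo hi ks st₁ st₂) :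
      InnerLoop C δ lo hi (k :: ks) st st₂

/-- `OuterLoop C δ d act ℓ st`: after the groups `0, …, ℓ - 1` of size `d`, the variables can have
the values `st`. For each group, the inner loop runs once through the elements of `act`, in any
order. -/
inductive OuterLoop (C : Fin K → Fin N → ℝ) (δ : ℝ) (d : ℕ) (act : Set (Fin K)) :
    ℕ → ReassignState K N → Prop
  | zero : OuterLoop C δ d act 0 (init C δ)
  | succ (l : ℕ) (st st' : ReassignState K N) (ks : List (Fin K)) (h : OuterLoop C δ d act l st)
      (hnodup : ks.Nodup) (hks : ∀ k, k ∈ ks ↔ k ∈ act)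
      (hloop : InnerLoop C δ (l * d) ((l + 1) * d) ks { st with next := l * d } st') :
      OuterLoop C δ d act (l + 1) st'

end ReassignState

namespace WCMDP

variable {S A : Type*} [Fintype S] [Fintype A] [DecidableEq S] {K N : ℕ}

/-- `σ` is a possible output of the ID reassignment algorithm: `σ i` is the new ID of arm `i`
(counted from `0`). Without active constraints the IDs are kept; otherwise the arms that got no new
ID in the loops receive the remaining new IDs in any way. -/
def IsReassignment (M : WCMDP S A K N) (α : Fin K → ℝ) (cmax : ℝ) (y : Fin N → S → A → ℝ)
    (σ : Equiv.Perm (Fin N)) : Prop :=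
  (M.activeSet α y = ∅ ∧ σ = 1) ∨
  ((M.activeSet α y).Nonempty ∧ ∃ st : ReassignState K N,
    ReassignState.OuterLoop (M.expCost y) (reassignThreshold α) (reassignGroupSize α cmax)
      (M.activeSet α y) (N / reassignGroupSize α cmax) st ∧
    ∀ i p, st.newID i = some p → ((σ i : Fin N) : ℕ) = p)

/-! #### The ID policy -/

open Classical in
/-- The executed actions, given the system state `s` and the ideal actions `a`: in the order of the
new IDs, the arms follow their ideal actions as long as the ideal actions up to and including the
present arm satisfy all budget constraints; from the first violation on, all arms idle. -/
noncomputable def executedAction (M : WCMDP S A K N) (α : Fin K → ℝ) (σ : Equiv.Perm (Fin N))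
    (s : Fin N → S) (a : Fin N → A) (i : Fin N) : A :=
  if ∀ q : Fin N, q ≤ σ i → ∀ k, ∑ j with σ j ≤ q, M.cost k j (s j) (a j) ≤ α k * N
  then a i else M.idle

/-- The ID policy with priorities `σ`: sample the ideal actions of the arms independently from their
single-armed policies, and execute them as in `executedAction`. -/
noncomputable def idPolicy (M : WCMDP S A K N) (α : Fin K → ℝ) (y : Fin N → S → A → ℝ)
    (hy : ∀ i s a, 0 ≤ y i s a) (σ : Equiv.Perm (Fin N)) : SysPolicy S A N :=
  fun _ s =>
    haveI : Nonempty A := ⟨M.idle⟩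
    (indepProd fun i => singleArmPolicy y hy i (s i)).map fun a => M.executedAction α σ s a

end WCMDP

namespace ReassignState

variable {K N : ℕ}

/-- An invariant that holds after at most `m` assignments. -/
structure Inv (C : Fin K → Fin N → ℝ) (δ : ℝ) (m : ℕ) (st : ReassignState K N) : Prop where
  card : ∀ k, {i | δ ≤ C k i}.ncard ≤ (st.cand k).ncard + m
  inj : ∀ i i' p, st.newID i = some p → st.newID i' = some p → i = i'
  lt : ∀ i p, st.newID i = some p → p < st.next

theorem Inv.assign {C : Fin K → Fin N → ℝ} {δ : ℝ} {m : ℕ} {st : ReassignState K N}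
    (h : Inv C δ m st) (i : Fin N) : Inv C δ (m + 1) (st.assign i) where
  card k := by
    have h1 := h.card k
    have h2 : (st.cand k).ncard ≤ (st.cand k \ {i}).ncard + ({i} : Set (Fin N)).ncard :=
      Set.ncard_le_ncard_sdiff_add_ncard _ _
    rw [Set.ncard_singleton] at h2
    simp only [ReassignState.assign]
    omega
  inj j j' p hj hj' := by
    simp only [ReassignState.assign, Function.update_apply] at hj hj'
    split_ifs at hj hj' with a b b
    · rw [a, b]
    · have := h.lt _ _ hj'
      simp at hj
      omega
    · have := h.lt _ _ hj
      simp at hj'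
      omega
    · exact h.inj _ _ _ hj hj'
  lt j p hj := by
    simp only [ReassignState.assign, Function.update_apply] at hj ⊢
    split_ifs at hj with a
    · simp at hj
      omega
    · have := h.lt _ _ hj
      omega

theorem exists_innerLoop (C : Fin K → Fin N → ℝ) (δ : ℝ) (lo hi : ℕ) (ks : List (Fin K)) :
    ∀ (m : ℕ) (st : ReassignState K N), Inv C δ m st →
      (∀ k ∈ ks, m + ks.length ≤ {i | δ ≤ C k i}.ncard) →
      ∃ st', InnerLoop C δ lo hi ks st st' ∧ Inv C δ (m + ks.length) st' ∧
        st'.next ≤ st.next + ks.length := by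
  induction ks with
  | nil => exact fun m st h _ => ⟨st, .nil st, h, le_rfl⟩
  | cons k ks ih =>
    intro m st h hc
    by_cases hs : δ ≤ st.segmentSum (C k) lo hi
    · obtain ⟨st', h1, h2, h3⟩ := ih m st h fun k' hk' => by
        have := hc k' (List.mem_cons_of_mem _ hk')
        simp at this
        omega
      refine ⟨st', .cons k ks st st st' (.skip st hs) h1, ⟨fun k' => ?_, h2.inj, h2.lt⟩, ?_⟩
      · have := h2.card k'
        simp
        omega
      · simp
        omega
    · have hk := hc k List.mem_cons_self
      have hk' := h.card k
      simp only [List.length_cons] at hk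
      have hne : (st.cand k).Nonempty := by
        rw [Set.nonempty_iff_ne_empty]
        intro h0
        rw [h0, Set.ncard_empty] at hk'
        omega
      obtain ⟨i, hi'⟩ := hne
      obtain ⟨st', h1, h2, h3⟩ := ih (m + 1) (st.assign i) (h.assign i) fun k' hk' => by
        have := hc k' (List.mem_cons_of_mem _ hk')
        simp at this
        omega
      refine ⟨st', .cons k ks st _ st' (.pick st i (not_le.mp hs) hi') h1, ?_, ?_⟩
      · rw [List.length_cons, add_comm ks.length, ← add_assoc]
        exact h2
      · simp only [ReassignState.assign] at h3
        simp
        omega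

theorem exists_outerLoop (C : Fin K → Fin N → ℝ) (δ : ℝ) (d : ℕ) (act : Set (Fin K))
    (hd : K ≤ d) (L : ℕ) (hact : ∀ k ∈ act, K * L ≤ {i | δ ≤ C k i}.ncard) :
    ∀ l ≤ L, ∃ st, OuterLoop C δ d act l st ∧ Inv C δ (K * l) st ∧ st.next ≤ l * d := by
  classical
  intro l
  induction l with
  | zero =>
    exact fun _ => ⟨_, .zero, ⟨fun k => by simp [init], by simp [init], by simp [init]⟩,
      by simp [init]⟩
  | succ l ih =>
    intro hl
    obtain ⟨st, h1, h2, h3⟩ := ih (by omega)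
    have hlen : (act.toFinset.toList).length ≤ K := by
      rw [Finset.length_toList]
      simpa using Finset.card_le_univ act.toFinset
    have hinv : Inv C δ (K * l) { st with next := l * d } :=
      ⟨h2.card, h2.inj, fun i p hp => lt_of_lt_of_le (h2.lt i p hp) h3⟩
    obtain ⟨st', g1, g2, g3⟩ := exists_innerLoop C δ (l * d) ((l + 1) * d) act.toFinset.toList
      (K * l) _ hinv fun k hk => by
        have h4 := hact k (by simpa using hk)
        have h5 : K * (l + 1) ≤ K * L := Nat.mul_le_mul_left _ hl
        rw [mul_add, mul_one] at h5
        omega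
    refine ⟨st', .succ l st st' _ h1 (Finset.nodup_toList _) (by simp) g1,
      ⟨fun k => ?_, g2.inj, g2.lt⟩, ?_⟩
    · have := g2.card k
      rw [mul_add, mul_one]
      omega
    · simp only at g3
      rw [add_mul, one_mul]
      omega

end ReassignState

/-- The ID reassignment algorithm never gets stuck: it has an output. -/
theorem WCMDP.exists_isReassignment {S A : Type*} [Fintype S] [Fintype A] {K N : ℕ}
    (M : WCMDP S A K N) (hN : 0 < N) {α : Fin K → ℝ} (hα : ∀ k, 0 < α k) {cmax : ℝ}
    (hc : ∀ k i s a, M.cost k i s a ≤ cmax) {y : Fin N → S → A → ℝ}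
    (hy : M.IsLPFeasible α y) : ∃ σ, M.IsReassignment α cmax y σ := by
  classical
  rcases (M.activeSet α y).eq_empty_or_nonempty with h0 | ⟨k₀, hk₀⟩
  · exact ⟨1, .inl ⟨h0, rfl⟩⟩
  have hK : 0 < K := k₀.pos
  have : Nonempty (Fin K) := ⟨k₀⟩
  set δ := reassignThreshold α with hδ
  set am := ⨅ k, α k with ham
  have ham_le : ∀ k, am ≤ α k := fun k => ciInf_le (Finite.bddBelow_range α) k
  have ham_pos : 0 < am := by
    obtain ⟨k, hk⟩ := exists_eq_ciInf_of_finite (f := α)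
    rw [ham, ← hk]
    exact hα k
  have hδ' : δ = am / 4 := rfl
  have hCle : ∀ k i, M.expCost y k i ≤ cmax := fun k i => by
    calc M.expCost y k i ≤ ∑ s, ∑ a, y i s a * cmax :=
          Finset.sum_le_sum fun s _ => Finset.sum_le_sum fun a _ =>
            mul_le_mul_of_nonneg_left (hc k i s a) (hy.nonneg i s a)
      _ = cmax := by simp_rw [← Finset.sum_mul]; rw [hy.total i, one_mul]
  have hNr : (0 : ℝ) < N := by exact_mod_cast hN
  -- counting the candidates
  have hcount : ∀ k ∈ M.activeSet α y,
      (am / 4) * N ≤ (cmax - δ) * ({i | δ ≤ M.expCost y k i}.ncard : ℝ) := by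
    intro k hk
    have h1 : α k / 2 * N ≤ ∑ i, M.expCost y k i := hk
    have h2 : ∑ i, M.expCost y k i ≤
        ∑ i, (δ + if δ ≤ M.expCost y k i then (cmax - δ) else 0) := by
      refine Finset.sum_le_sum fun i _ => ?_
      split_ifs with h
      · have := hCle k i
        linarith
      · linarith [not_le.mp h]
    rw [Finset.sum_add_distrib, ← Finset.sum_filter] at h2
    simp only [Finset.sum_const, Finset.card_univ, Fintype.card_fin, nsmul_eq_mul] at h2
    have h3 : ({i | δ ≤ M.expCost y k i}.ncard : ℝ)
        = ((Finset.univ.filter fun i => δ ≤ M.expCost y k i).card : ℝ) := by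
      rw [← Set.ncard_coe_finset]
      congr 2
      ext i
      simp
    rw [h3]
    have h4 : am / 2 * N ≤ α k / 2 * N := by
      have := ham_le k
      gcongr
    rw [hδ'] at *
    linarith
  have hcm : am / 4 ≤ cmax - δ := by
    have h1 : α k₀ / 2 * N ≤ ∑ i, M.expCost y k₀ i := hk₀
    have h2 : ∑ i, M.expCost y k₀ i ≤ ∑ _i : Fin N, cmax :=
      Finset.sum_le_sum fun i _ => hCle k₀ i
    simp only [Finset.sum_const, Finset.card_univ, Fintype.card_fin, nsmul_eq_mul] at h2
    have h3 := ham_le k₀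
    have h4 : α k₀ / 2 ≤ cmax := by
      by_contra h
      push Not at h
      have := mul_lt_mul_of_pos_right h hNr
      linarith
    linarith
  set d := reassignGroupSize α cmax with hd
  have hdr : (cmax - δ) * K / (am / 4) ≤ d := by
    have : am / 4 = am / 2 - δ := by rw [hδ']; ring
    rw [this]
    exact Nat.le_ceil _
  have hKr : (0 : ℝ) < K := by exact_mod_cast hK
  have hKd : K ≤ d := by
    have : (K : ℝ) ≤ d := by
      refine le_trans ?_ hdr
      rw [le_div_iff₀ (by positivity), mul_comm]
      gcongr
    exact_mod_cast this
  have hact : ∀ k ∈ M.activeSet α y, K * (N / d) ≤ {i | δ ≤ M.expCost y k i}.ncard := by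
    intro k hk
    have h1 := hcount k hk
    have hpos : 0 < cmax - δ := by linarith
    have h2 : ((N / d : ℕ) : ℝ) * d ≤ N := by exact_mod_cast Nat.div_mul_le_self N d
    have h3 : ((N / d : ℕ) : ℝ) * ((cmax - δ) * K / (am / 4)) ≤ N :=
      le_trans (by gcongr) h2
    have h4 : ((N / d : ℕ) : ℝ) * ((cmax - δ) * K) ≤ N * (am / 4) := by
      rw [← mul_div_assoc, div_le_iff₀ (by positivity)] at h3
      exact h3
    have h5 : (cmax - δ) * ((K : ℝ) * (N / d : ℕ))
        ≤ (cmax - δ) * ({i | δ ≤ M.expCost y k i}.ncard : ℝ) := by linarith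
    exact_mod_cast le_of_mul_le_mul_left h5 hpos
  obtain ⟨st, h1, h2, h3⟩ := ReassignState.exists_outerLoop (M.expCost y) δ d (M.activeSet α y)
    hKd (N / d) hact (N / d) le_rfl
  have hlt : ∀ i p, st.newID i = some p → p < N := fun i p hp =>
    lt_of_lt_of_le (h2.lt i p hp) (h3.trans (Nat.div_mul_le_self N d))
  let f : Fin N → Fin N := fun i => ⟨(st.newID i).getD 0 % N, Nat.mod_lt _ hN⟩
  have hf : ∀ i p, st.newID i = some p → (f i : ℕ) = p := fun i p hp => by
    simp [f, hp, Nat.mod_eq_of_lt (hlt i p hp)]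
  have hinj : Set.InjOn f {i | (st.newID i).isSome} := by
    intro i hi j hj hij
    obtain ⟨p, hp⟩ := Option.isSome_iff_exists.mp hi
    obtain ⟨q, hq⟩ := Option.isSome_iff_exists.mp hj
    have : p = q := by rw [← hf i p hp, ← hf j q hq, hij]
    exact h2.inj i j p hp (this ▸ hq)
  obtain ⟨g, hg⟩ := Set.MapsTo.exists_equiv_extend_of_card_eq
    (t := (Finset.univ : Finset (Fin N))) (by simp) (f := f)
    (s := {i | (st.newID i).isSome}) (by intro i _; simp) hinj
  refine ⟨g.trans (Equiv.subtypeUnivEquiv (by simp)), .inr ⟨⟨k₀, hk₀⟩, st, h1, fun i p hp => ?_⟩⟩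
  have := hg i (by simp [hp])
  simpa [Equiv.subtypeUnivEquiv, this] using hf i p hp

/-! The proof compares both sides with the LP value. Upper side: the time-averaged state-action
frequencies of an admissible policy meet the LP constraints up to a stationarity defect `1 / T`. A
subsequential limit is therefore feasible, and the LP value bounds the optimal value
(`optValue_le_lpObjective`).

Lower side: an arm in state `s` is described by its features, namely the reward and each cost,
averaged over the ideal action, centred at the LP value and pushed `l` steps ahead by the arm's
chain. Mixing makes them decay like `γ ^ (2 * l)` (`abs_chainFeature_le`). Half of this decay pays
for the weights `γ ^ (-l)` in `featureNorm`. As long as a prefix of arms follows its ideal actions,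
a time step shifts the features, and so multiplies the prefix norm by `γ`, up to noise. A Doob-type
maximal inequality (`pmfExp_psumSup_le`) bounds the noise of all prefixes at once by `O(√N)`.

The reassignment spreads costly arms over all ID groups, so omitting the last `w` arms frees budget
at a rate `β * w` (`psum_expCost_le`). Let the potential be the least `V` such that for every `w ≥
V` the first `N - w` arms have norm at most `β / 2 * w`. Such prefixes fit the budget when the noise
is small relative to `w`, hence they follow their ideal actions and their norm contracts. The
contraction leaves room to enlarge the prefix, and the potential shrinks by a factor `1 / (1 + ε)`
up to noise (`potential_next_le`). Its mean at time `t` is thus at most `(1 + ε) ^ (-t) * N +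
O(√N)`.

The expected reward lost in one step, against the LP, is at most a multiple of the potential plus
`O(√N)` (`le_pmfExp_reward`). Averaging over time and arms turns the geometric part into `O(1 / T)`
and the rest into `O(1 / √N)`. -/

/-! ### Expectations on finite types -/

section Expectation

variable {α β : Type*} [Fintype α] [Fintype β]

/-- The expectation of `f` under a law on a finite type. -/
noncomputable def pmfExp (p : PMF α) (f : α → ℝ) : ℝ := ∑ x, (p x).toReal * f x

theorem sum_toReal_pmf (p : PMF α) : ∑ x, (p x).toReal = 1 := by
  have h := p.tsum_coe
  rw [tsum_fintype] at h
  rw [← ENNReal.toReal_sum fun x _ => p.apply_ne_top x, h, ENNReal.toReal_one]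

theorem pmfExp_mono (p : PMF α) {f g : α → ℝ} (h : ∀ x, f x ≤ g x) : pmfExp p f ≤ pmfExp p g :=
  Finset.sum_le_sum fun x _ => mul_le_mul_of_nonneg_left (h x) ENNReal.toReal_nonneg

theorem pmfExp_const (p : PMF α) (c : ℝ) : pmfExp p (fun _ => c) = c := by
  simp_rw [pmfExp, ← Finset.sum_mul, sum_toReal_pmf, one_mul]

theorem pmfExp_nonneg (p : PMF α) {f : α → ℝ} (h : ∀ x, 0 ≤ f x) : 0 ≤ pmfExp p f :=
  Finset.sum_nonneg fun x _ => mul_nonneg ENNReal.toReal_nonneg (h x)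

theorem pmfExp_add (p : PMF α) (f g : α → ℝ) :
    pmfExp p (fun x => f x + g x) = pmfExp p f + pmfExp p g := by
  simp_rw [pmfExp, mul_add, Finset.sum_add_distrib]

theorem pmfExp_sub (p : PMF α) (f g : α → ℝ) :
    pmfExp p (fun x => f x - g x) = pmfExp p f - pmfExp p g := by
  simp_rw [pmfExp, mul_sub, Finset.sum_sub_distrib]

theorem pmfExp_const_mul (p : PMF α) (c : ℝ) (f : α → ℝ) :
    pmfExp p (fun x => c * f x) = c * pmfExp p f := by
  simp_rw [pmfExp, Finset.mul_sum, mul_left_comm]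

theorem pmfExp_sum {ι : Type*} (s : Finset ι) (p : PMF α) (f : ι → α → ℝ) :
    pmfExp p (fun x => ∑ i ∈ s, f i x) = ∑ i ∈ s, pmfExp p (f i) := by
  simp_rw [pmfExp, Finset.mul_sum]
  exact Finset.sum_comm

theorem abs_pmfExp_le (p : PMF α) {f : α → ℝ} {b : ℝ} (h : ∀ x, |f x| ≤ b) :
    |pmfExp p f| ≤ b := by
  refine abs_le.mpr ⟨?_, ?_⟩
  · rw [← pmfExp_const p (-b)]
    exact pmfExp_mono p fun x => (abs_le.mp (h x)).1
  · rw [← pmfExp_const p b]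
    exact pmfExp_mono p fun x => (abs_le.mp (h x)).2

theorem pmfExp_tsum (p : PMF α) {f : ℕ → α → ℝ} (h : ∀ x, Summable fun l => f l x) :
    pmfExp p (fun x => ∑' l, f l x) = ∑' l, pmfExp p (f l) := by
  simp_rw [pmfExp, ← tsum_mul_left]
  exact (Summable.tsum_finsetSum fun x _ => (h x).mul_left _).symm

/-- The variance is nonnegative: expand the mean of `(f x - c) ^ 2`, with `c` the mean of `f`. -/
theorem sq_pmfExp_le (p : PMF α) (f : α → ℝ) : pmfExp p f ^ 2 ≤ pmfExp p fun x => f x ^ 2 := by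
  set c := pmfExp p f with hc
  have h : 0 ≤ pmfExp p fun x => f x ^ 2 - (2 * c * f x - c ^ 2) :=
    pmfExp_nonneg p fun x => by nlinarith [sq_nonneg (f x - c)]
  rw [pmfExp_sub, pmfExp_sub, pmfExp_const_mul, pmfExp_const, ← hc] at h
  nlinarith

theorem pmfExp_bind (p : PMF α) (q : α → PMF β) (f : β → ℝ) :
    pmfExp (p.bind q) f = pmfExp p fun x => pmfExp (q x) f := by
  have h : ∀ y, ((p.bind q) y).toReal = ∑ x, (p x).toReal * (q x y).toReal := fun y => by
    rw [PMF.bind_apply, tsum_fintype,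
      ENNReal.toReal_sum fun x _ => ENNReal.mul_ne_top (p.apply_ne_top x) ((q x).apply_ne_top y)]
    simp_rw [ENNReal.toReal_mul]
  simp_rw [pmfExp, h, Finset.sum_mul, Finset.mul_sum, ← mul_assoc]
  exact Finset.sum_comm

theorem pmfExp_pure (x : α) (f : α → ℝ) : pmfExp (PMF.pure x) f = f x := by
  classical
  rw [pmfExp, Finset.sum_eq_single x]
  · simp
  · intro y _ hy
    simp [hy]
  · simp

theorem pmfExp_map (p : PMF α) (g : α → β) (f : β → ℝ) :
    pmfExp (p.map g) f = pmfExp p fun x => f (g x) := by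
  rw [PMF.map, pmfExp_bind]
  simp_rw [Function.comp_apply, pmfExp_pure]

end Expectation

/-! ### Product laws: resampling and orthogonality -/

section IndepProd

variable {N : ℕ} {β : Type*} [Fintype β]

theorem toReal_indepProd (p : Fin N → PMF β) (x : Fin N → β) :
    (indepProd p x).toReal = ∏ i, (p i (x i)).toReal := by
  rw [indepProd, PMF.ofFintype_apply, ENNReal.toReal_prod]

/-- Resampling one coordinate does not change an expectation under a product law. -/
theorem pmfExp_indepProd_resample (p : Fin N → PMF β) (j : Fin N) (φ : (Fin N → β) → ℝ) :
    pmfExp (indepProd p) φ =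
      pmfExp (indepProd p) fun x => pmfExp (p j) fun b => φ (Function.update x j b) := by
  classical
  -- Exchanging the `j`-th coordinate with the fresh sample is an involution that preserves the
  -- joint weight.
  let e : (Fin N → β) × β ≃ (Fin N → β) × β :=
    { toFun := fun z => (Function.update z.1 j z.2, z.1 j)
      invFun := fun z => (Function.update z.1 j z.2, z.1 j)
      left_inv := fun z => by simp
      right_inv := fun z => by simp }
  have hw : ∀ (x : Fin N → β) (b : β),
      (indepProd p (Function.update x j b)).toReal * (p j (x j)).toReal
        = (indepProd p x).toReal * (p j b).toReal := fun x b => by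
    rw [toReal_indepProd, toReal_indepProd, ← Finset.mul_prod_erase _ _ (Finset.mem_univ j),
      ← Finset.mul_prod_erase _ (fun i => (p i (x i)).toReal) (Finset.mem_univ j),
      Finset.prod_congr rfl (g := fun i => (p i (x i)).toReal) fun i hi => by
        rw [Function.update_of_ne (Finset.ne_of_mem_erase hi)], Function.update_self]
    ring
  have h1 : pmfExp (indepProd p) (fun x => pmfExp (p j) fun b => φ (Function.update x j b))
      = ∑ z : (Fin N → β) × β, (indepProd p z.1).toReal * (p j z.2).toReal *
          φ (Function.update z.1 j z.2) := by
    rw [Fintype.sum_prod_type]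
    simp_rw [pmfExp, Finset.mul_sum, mul_assoc]
  rw [h1, ← e.sum_comp, Fintype.sum_prod_type]
  refine Finset.sum_congr rfl fun x _ => ?_
  calc (indepProd p x).toReal * φ x
      = ∑ b, (indepProd p x).toReal * (p j b).toReal * φ x := by
        rw [← Finset.sum_mul, ← Finset.mul_sum, sum_toReal_pmf, mul_one]
    _ = _ := Finset.sum_congr rfl fun b _ => by
        rw [← hw x b]
        simp [e]

theorem pmfExp_indepProd_coord (p : Fin N → PMF β) (j : Fin N) (φ : β → ℝ) :
    pmfExp (indepProd p) (fun x => φ (x j)) = pmfExp (p j) φ := by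
  rw [pmfExp_indepProd_resample p j]
  simp_rw [Function.update_self]
  exact pmfExp_const _ _

/-- A centred function of one coordinate is orthogonal to the functions of the others. -/
theorem pmfExp_indepProd_mul_eq_zero (p : Fin N → PMF β) (j : Fin N) (F : (Fin N → β) → ℝ)
    (hF : ∀ x b, F (Function.update x j b) = F x) (φ : β → ℝ) (hφ : pmfExp (p j) φ = 0) :
    pmfExp (indepProd p) (fun x => F x * φ (x j)) = 0 := by
  rw [pmfExp_indepProd_resample p j]
  simp_rw [Function.update_self, hF, pmfExp_const_mul, hφ, mul_zero]
  exact pmfExp_const _ _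

end IndepProd

/-! ### Partial sums along a permutation, and a maximal inequality -/

section PartialSums

variable {N : ℕ}

/-- The sum of `z i` over the `m` indices that come first in the order given by `σ`. -/
def psum (σ : Equiv.Perm (Fin N)) (m : ℕ) (z : Fin N → ℝ) : ℝ :=
  ∑ i with (σ i : ℕ) < m, z i

theorem psum_zero (σ : Equiv.Perm (Fin N)) (z : Fin N → ℝ) : psum σ 0 z = 0 := by
  simp [psum]

theorem psum_card (σ : Equiv.Perm (Fin N)) (z : Fin N → ℝ) : psum σ N z = ∑ i, z i := by
  simp [psum]

theorem psum_of_le (σ : Equiv.Perm (Fin N)) {m : ℕ} (h : N ≤ m) (z : Fin N → ℝ) :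
    psum σ m z = ∑ i, z i := by
  rw [psum, Finset.filter_true_of_mem]
  exact fun i _ => lt_of_lt_of_le (σ i).2 h

theorem psum_add (σ : Equiv.Perm (Fin N)) (m : ℕ) (z w : Fin N → ℝ) :
    psum σ m (fun i => z i + w i) = psum σ m z + psum σ m w :=
  Finset.sum_add_distrib

theorem psum_neg (σ : Equiv.Perm (Fin N)) (m : ℕ) (z : Fin N → ℝ) :
    psum σ m (fun i => -z i) = -psum σ m z :=
  Finset.sum_neg_distrib _

theorem psum_congr (σ : Equiv.Perm (Fin N)) {m : ℕ} {z w : Fin N → ℝ}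
    (h : ∀ i, (σ i : ℕ) < m → z i = w i) : psum σ m z = psum σ m w :=
  Finset.sum_congr rfl fun i hi => h i (Finset.mem_filter.mp hi).2

theorem psum_succ (σ : Equiv.Perm (Fin N)) (m : ℕ) (hm : m < N) (z : Fin N → ℝ) :
    psum σ (m + 1) z = psum σ m z + z (σ.symm ⟨m, hm⟩) := by
  have h : (Finset.univ.filter fun i => (σ i : ℕ) < m + 1)
      = insert (σ.symm ⟨m, hm⟩) (Finset.univ.filter fun i => (σ i : ℕ) < m) := by
    ext i
    simp only [Finset.mem_filter, Finset.mem_univ, true_and, Finset.mem_insert,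
      Equiv.eq_symm_apply, Fin.ext_iff]
    omega
  rw [psum, h, Finset.sum_insert (by simp), add_comm, psum]

theorem abs_psum_sub_psum_le (σ : Equiv.Perm (Fin N)) {b : ℝ} {z : Fin N → ℝ}
    (hz : ∀ i, |z i| ≤ b) (hb : 0 ≤ b) {m m' : ℕ} (h : m ≤ m') :
    |psum σ m' z - psum σ m z| ≤ b * (m' - m : ℝ) := by
  induction m', h using Nat.le_induction with
  | base => simp
  | succ n hn ih =>
    push_cast
    by_cases hN : n < N
    · rw [psum_succ σ n hN, add_sub_right_comm]
      refine (abs_add_le _ _).trans ?_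
      have := hz (σ.symm ⟨n, hN⟩)
      linarith
    · rw [psum_of_le σ (not_lt.mp hN)] at ih
      rw [psum_of_le σ ((not_lt.mp hN).trans n.le_succ)]
      linarith

theorem abs_psum_le (σ : Equiv.Perm (Fin N)) {b : ℝ} {z : Fin N → ℝ}
    (hz : ∀ i, |z i| ≤ b) (hb : 0 ≤ b) (m : ℕ) : |psum σ m z| ≤ b * m := by
  simpa [psum_zero] using abs_psum_sub_psum_le σ hz hb (Nat.zero_le m)

/-- The running maximum of the partial sums. -/
noncomputable def psumMax (σ : Equiv.Perm (Fin N)) (z : Fin N → ℝ) : ℕ → ℝ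
  | 0 => 0
  | m + 1 => max (psumMax σ z m) (psum σ (m + 1) z)

theorem psumMax_nonneg (σ : Equiv.Perm (Fin N)) (z : Fin N → ℝ) (m : ℕ) : 0 ≤ psumMax σ z m := by
  induction m with
  | zero => exact le_rfl
  | succ m ih => exact ih.trans (le_max_left _ _)

theorem psum_le_psumMax (σ : Equiv.Perm (Fin N)) (z : Fin N → ℝ) {m m' : ℕ} (h : m ≤ m') :
    psum σ m z ≤ psumMax σ z m' := by
  induction m', h using Nat.le_induction with
  | base =>
    cases m with
    | zero => exact (psum_zero σ z).le
    | succ m => exact le_max_right _ _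
  | succ n _ ih => exact ih.trans (le_max_left _ _)

/-- Adaptedness: what precedes `j` in the order does not see coordinate `j`. This makes the
orthogonality of centred increments applicable below. -/
theorem psum_congr_update (σ : Equiv.Perm (Fin N)) {m : ℕ} {z w : Fin N → ℝ} {j : Fin N}
    (hj : m ≤ σ j) (h : ∀ i, i ≠ j → z i = w i) : psum σ m z = psum σ m w :=
  psum_congr σ fun i hi => h i (by rintro rfl; omega)

theorem psumMax_congr_update (σ : Equiv.Perm (Fin N)) {m : ℕ} {z w : Fin N → ℝ} {j : Fin N}
    (hj : m ≤ σ j) (h : ∀ i, i ≠ j → z i = w i) : psumMax σ z m = psumMax σ w m := by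
  induction m with
  | zero => rfl
  | succ m ih => rw [psumMax, psumMax, ih (by omega), psum_congr_update σ hj h]

/-- A bound for the absolute values of all partial sums. -/
noncomputable def psumSup (σ : Equiv.Perm (Fin N)) (z : Fin N → ℝ) : ℝ :=
  psumMax σ z N + psumMax σ (fun i => -z i) N

theorem psumSup_nonneg (σ : Equiv.Perm (Fin N)) (z : Fin N → ℝ) : 0 ≤ psumSup σ z :=
  add_nonneg (psumMax_nonneg _ _ _) (psumMax_nonneg _ _ _)

theorem abs_psum_le_psumSup (σ : Equiv.Perm (Fin N)) (z : Fin N → ℝ) (m : ℕ) :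
    |psum σ m z| ≤ psumSup σ z := by
  wlog hm : m ≤ N generalizing m
  · rw [psum_of_le σ (not_le.mp hm).le, ← psum_of_le σ le_rfl]
    exact this N le_rfl
  have h1 := psum_le_psumMax σ z hm
  have h2 := psum_le_psumMax σ (fun i => -z i) hm
  rw [psum_neg] at h2
  have h3 := psumMax_nonneg σ z N
  have h4 := psumMax_nonneg σ (fun i => -z i) N
  rw [psumSup]
  exact abs_le.mpr ⟨by linarith, by linarith⟩

variable {β : Type*} [Fintype β]

/-- Each new increment is centred and orthogonal to the partial sum before it, so the second moments
add up. -/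
theorem pmfExp_psum_sq_le (σ : Equiv.Perm (Fin N)) (p : Fin N → PMF β) (ψ : Fin N → β → ℝ)
    {b : ℝ} (hψ : ∀ i x, |ψ i x| ≤ b) (h0 : ∀ i, pmfExp (p i) (ψ i) = 0) (m : ℕ) (hm : m ≤ N) :
    pmfExp (indepProd p) (fun x => psum σ m (fun i => ψ i (x i)) ^ 2) ≤ m * b ^ 2 := by
  induction m with
  | zero => simp [psum_zero, pmfExp_const]
  | succ m ih =>
    set j := σ.symm ⟨m, hm⟩ with hj
    have hσj : (σ j : ℕ) = m := by simp [hj]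
    have h1 : pmfExp (indepProd p) (fun x => psum σ m (fun i => ψ i (x i)) * ψ j (x j)) = 0 :=
      pmfExp_indepProd_mul_eq_zero p j _ (fun x c => psum_congr_update σ hσj.ge fun i hi => by
        rw [Function.update_of_ne hi]) _ (h0 j)
    have h2 : ∀ x : Fin N → β, psum σ (m + 1) (fun i => ψ i (x i)) ^ 2 ≤
        psum σ m (fun i => ψ i (x i)) ^ 2 + (2 * (psum σ m (fun i => ψ i (x i)) * ψ j (x j))
          + b ^ 2) := fun x => by
      rw [psum_succ σ m hm, ← hj]
      have : ψ j (x j) ^ 2 ≤ b ^ 2 := sq_le_sq' (abs_le.mp (hψ j _)).1 (abs_le.mp (hψ j _)).2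
      nlinarith
    refine (pmfExp_mono _ h2).trans ?_
    rw [pmfExp_add, pmfExp_add, pmfExp_const_mul, h1, pmfExp_const]
    push_cast
    linarith [ih (by omega)]

/-- The algebraic core of Doob's `L²` inequality. With `M` the running maximum and `Q` the new
partial sum, replacing `M` by `max M Q` changes `2 * M * Q - M ^ 2` by `(Q - M) ^ 2` or by zero, and
the new increment is orthogonal to the old `M`. -/
theorem pmfExp_psumMax_sq_le (σ : Equiv.Perm (Fin N)) (p : Fin N → PMF β) (ψ : Fin N → β → ℝ)
    (h0 : ∀ i, pmfExp (p i) (ψ i) = 0) (m : ℕ) (hm : m ≤ N) :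
    0 ≤ pmfExp (indepProd p) (fun x => 2 * (psumMax σ (fun i => ψ i (x i)) m *
      psum σ m (fun i => ψ i (x i))) - psumMax σ (fun i => ψ i (x i)) m ^ 2) := by
  induction m with
  | zero => simp [psumMax, psum_zero, pmfExp_const]
  | succ m ih =>
    set j := σ.symm ⟨m, hm⟩ with hj
    have hσj : (σ j : ℕ) = m := by simp [hj]
    have h1 : pmfExp (indepProd p) (fun x => psumMax σ (fun i => ψ i (x i)) m * ψ j (x j)) = 0 :=
      pmfExp_indepProd_mul_eq_zero p j _ (fun x c => psumMax_congr_update σ hσj.ge fun i hi => by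
        rw [Function.update_of_ne hi]) _ (h0 j)
    have h2 : 0 ≤ pmfExp (indepProd p) (fun x => (2 * (psumMax σ (fun i => ψ i (x i)) m *
        psum σ m (fun i => ψ i (x i))) - psumMax σ (fun i => ψ i (x i)) m ^ 2) +
        2 * (psumMax σ (fun i => ψ i (x i)) m * ψ j (x j))) := by
      rw [pmfExp_add, pmfExp_const_mul, h1]
      simpa using ih (by omega)
    refine h2.trans (pmfExp_mono _ fun x => ?_)
    rw [psumMax]
    set M := psumMax σ (fun i => ψ i (x i)) m
    have h3 : psum σ (m + 1) (fun i => ψ i (x i)) = psum σ m (fun i => ψ i (x i)) + ψ j (x j) :=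
      psum_succ σ m hm _
    set Q := psum σ (m + 1) (fun i => ψ i (x i))
    have h4 : M * psum σ m (fun i => ψ i (x i)) + M * ψ j (x j) = M * Q := by rw [h3]; ring
    rcases le_total M Q with h | h
    · rw [max_eq_right h]
      nlinarith [sq_nonneg (Q - M)]
    · rw [max_eq_left h]
      linarith

/-- Since `2 * M * Q ≤ 2 * Q ^ 2 + M ^ 2 / 2`, the second moment of the maximum is at most four
times that of the final sum. `sq_pmfExp_le` passes to the first moment. -/
theorem pmfExp_psumMax_le (σ : Equiv.Perm (Fin N)) (p : Fin N → PMF β) (ψ : Fin N → β → ℝ)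
    {b : ℝ} (hb : 0 ≤ b) (hψ : ∀ i x, |ψ i x| ≤ b) (h0 : ∀ i, pmfExp (p i) (ψ i) = 0) :
    pmfExp (indepProd p) (fun x => psumMax σ (fun i => ψ i (x i)) N) ≤ 2 * b * √N := by
  have h1 := pmfExp_psumMax_sq_le σ p ψ h0 N le_rfl
  have h2 := pmfExp_psum_sq_le σ p ψ hψ h0 N le_rfl
  have h3 : pmfExp (indepProd p) (fun x => 2 * (psumMax σ (fun i => ψ i (x i)) N *
      psum σ N (fun i => ψ i (x i))) - psumMax σ (fun i => ψ i (x i)) N ^ 2) ≤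
      pmfExp (indepProd p) (fun x => 2 * psum σ N (fun i => ψ i (x i)) ^ 2 -
        1 / 2 * psumMax σ (fun i => ψ i (x i)) N ^ 2) := pmfExp_mono _ fun x => by
    nlinarith [sq_nonneg (2 * psum σ N (fun i => ψ i (x i)) - psumMax σ (fun i => ψ i (x i)) N)]
  rw [pmfExp_sub (indepProd p) (fun x => 2 * psum σ N (fun i => ψ i (x i)) ^ 2)
      (fun x => 1 / 2 * psumMax σ (fun i => ψ i (x i)) N ^ 2),
    pmfExp_const_mul, pmfExp_const_mul] at h3
  have h4 := sq_pmfExp_le (indepProd p) (fun x => psumMax σ (fun i => ψ i (x i)) N)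
  refine abs_le_of_sq_le_sq' ?_ (by positivity) |>.2
  rw [mul_pow, Real.sq_sqrt (Nat.cast_nonneg N)]
  nlinarith

/-- A maximal inequality for sums of independent bounded variables. -/
theorem pmfExp_psumSup_le (σ : Equiv.Perm (Fin N)) (p : Fin N → PMF β) (ψ : Fin N → β → ℝ)
    {b : ℝ} (hb : 0 ≤ b) (hψ : ∀ i x, |ψ i x| ≤ b) :
    pmfExp (indepProd p) (fun x => psumSup σ fun i => ψ i (x i) - pmfExp (p i) (ψ i))
      ≤ 8 * b * √N := by
  -- Centring doubles the bound to `2 * b`, and each of the two signs then contributes `4 * b * √N`.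
  have h0 : ∀ i x, |ψ i x - pmfExp (p i) (ψ i)| ≤ 2 * b := fun i x =>
    (abs_sub _ _).trans (by linarith [hψ i x, abs_pmfExp_le (p i) (hψ i)])
  have h1 : ∀ i, pmfExp (p i) (fun x => ψ i x - pmfExp (p i) (ψ i)) = 0 := fun i => by
    rw [pmfExp_sub, pmfExp_const, sub_self]
  have h2 : ∀ i, pmfExp (p i) (fun x => -(ψ i x - pmfExp (p i) (ψ i))) = 0 := fun i => by
    simp_rw [← neg_one_mul (_ - _), pmfExp_const_mul, h1, mul_zero]
  have h3 := pmfExp_psumMax_le σ p (fun i x => ψ i x - pmfExp (p i) (ψ i)) (by linarith) h0 h1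
  have h4 := pmfExp_psumMax_le σ p (fun i x => -(ψ i x - pmfExp (p i) (ψ i))) (b := 2 * b)
    (by linarith) (fun i x => by rw [abs_neg]; exact h0 i x) h2
  simp_rw [psumSup, pmfExp_add]
  linarith

end PartialSums

theorem pmfExp_le_of_support {α : Type*} [Fintype α] (p : PMF α) {f : α → ℝ} {c : ℝ}
    (h : ∀ x ∈ p.support, f x ≤ c) : pmfExp p f ≤ c := by
  rw [← pmfExp_const p c]
  refine Finset.sum_le_sum fun x _ => ?_
  by_cases hx : p x = 0
  · simp [hx]
  · exact mul_le_mul_of_nonneg_left (h x ((p.mem_support_iff x).mpr hx)) ENNReal.toReal_nonneg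

namespace WCMDP

variable {S A : Type*} [Fintype S] [Fintype A] [DecidableEq S] {K N : ℕ}

/-! ### Laws of the system state -/

/-- The law of the system state at time `t`. -/
noncomputable def stateLaw (M : WCMDP S A K N) (π : SysPolicy S A N) (s₀ : Fin N → S) (t : ℕ) :
    PMF (Fin N → S) :=
  (M.histLaw π s₀ t).map Prod.snd

omit [Fintype A] [DecidableEq S] in
theorem stateActionLaw_map_fst (M : WCMDP S A K N) (π : SysPolicy S A N) (s₀ : Fin N → S)
    (t : ℕ) : (M.stateActionLaw π s₀ t).map Prod.fst = M.stateLaw π s₀ t := by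
  rw [stateActionLaw, stateLaw, PMF.map_bind, ← PMF.bind_pure_comp]
  refine congrArg _ (funext fun hs => ?_)
  rw [PMF.map_comp]
  exact PMF.map_const _ _

omit [Fintype A] [DecidableEq S] in
theorem stateLaw_succ (M : WCMDP S A K N) (π : SysPolicy S A N) (s₀ : Fin N → S) (t : ℕ) :
    M.stateLaw π s₀ (t + 1) =
      (M.stateActionLaw π s₀ t).bind fun x => M.sysTrans x.1 x.2 := by
  rw [stateActionLaw, stateLaw, histLaw, PMF.map_bind, PMF.bind_bind]
  refine congrArg _ (funext fun hs => ?_)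
  rw [PMF.map_bind, PMF.bind_map]
  refine congrArg _ (funext fun a => ?_)
  rw [PMF.map_comp]
  exact PMF.map_id _

omit [DecidableEq S] in
theorem pmfExp_stateLaw (M : WCMDP S A K N) (π : SysPolicy S A N) (s₀ : Fin N → S) (t : ℕ)
    (f : (Fin N → S) → ℝ) :
    pmfExp (M.stateLaw π s₀ t) f = pmfExp (M.stateActionLaw π s₀ t) fun x => f x.1 := by
  rw [← stateActionLaw_map_fst, pmfExp_map]

omit [DecidableEq S] in
theorem pmfExp_stateLaw_succ (M : WCMDP S A K N) (π : SysPolicy S A N) (s₀ : Fin N → S) (t : ℕ)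
    (f : (Fin N → S) → ℝ) :
    pmfExp (M.stateLaw π s₀ (t + 1)) f =
      pmfExp (M.stateActionLaw π s₀ t) fun x => pmfExp (M.sysTrans x.1 x.2) f := by
  rw [stateLaw_succ, pmfExp_bind]

/-! ### The LP value bounds the optimal value -/

/-- The state-action frequencies of arm `i` up to time `T`. -/
noncomputable def occupation (M : WCMDP S A K N) (π : SysPolicy S A N) (s₀ : Fin N → S)
    (T : ℕ) (i : Fin N) (s : S) (a : A) : ℝ :=
  1 / (T : ℝ) * ∑ t ∈ Finset.range T,
    ((M.stateActionLaw π s₀ t).map (fun x => (x.1 i, x.2 i)) (s, a)).toReal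

omit [DecidableEq S] in
theorem sum_occupation_mul (M : WCMDP S A K N) (π : SysPolicy S A N) (s₀ : Fin N → S)
    (T : ℕ) (i : Fin N) (g : S → A → ℝ) :
    ∑ s, ∑ a, M.occupation π s₀ T i s a * g s a = 1 / (T : ℝ) * ∑ t ∈ Finset.range T,
      pmfExp (M.stateActionLaw π s₀ t) fun x => g (x.1 i) (x.2 i) := by
  have h : ∀ t, pmfExp (M.stateActionLaw π s₀ t) (fun x => g (x.1 i) (x.2 i)) = ∑ s, ∑ a,
      ((M.stateActionLaw π s₀ t).map (fun x => (x.1 i, x.2 i)) (s, a)).toReal * g s a := fun t => by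
    rw [← Fintype.sum_prod_type'
      (f := fun s a => ((M.stateActionLaw π s₀ t).map (fun x => (x.1 i, x.2 i)) (s, a)).toReal
        * g s a)]
    exact (pmfExp_map (M.stateActionLaw π s₀ t) (fun x => (x.1 i, x.2 i))
      (fun z => g z.1 z.2)).symm
  simp_rw [h, occupation, Finset.mul_sum, Finset.sum_mul]
  simp_rw [Finset.sum_comm (s := Finset.range T), mul_assoc]

omit [Fintype A] [DecidableEq S] in
theorem occupation_nonneg (M : WCMDP S A K N) (π : SysPolicy S A N) (s₀ : Fin N → S)
    (T : ℕ) (i : Fin N) (s : S) (a : A) : 0 ≤ M.occupation π s₀ T i s a :=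
  mul_nonneg (by positivity) (Finset.sum_nonneg fun _ _ => ENNReal.toReal_nonneg)

omit [DecidableEq S] in
theorem sum_occupation (M : WCMDP S A K N) (π : SysPolicy S A N) (s₀ : Fin N → S)
    {T : ℕ} (hT : 0 < T) (i : Fin N) : ∑ s, ∑ a, M.occupation π s₀ T i s a = 1 := by
  have h := M.sum_occupation_mul π s₀ T i fun _ _ => 1
  simp_rw [mul_one, pmfExp_const] at h
  rw [h]
  have : (T : ℝ) ≠ 0 := by positivity
  simp [this]

omit [DecidableEq S] in
theorem avgReward_eq_lpObjective (M : WCMDP S A K N) (π : SysPolicy S A N) (s₀ : Fin N → S)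
    (T : ℕ) : M.avgReward π s₀ T = M.lpObjective (M.occupation π s₀ T) := by
  simp_rw [avgReward, lpObjective, sum_occupation_mul, ← Finset.mul_sum]
  rw [Finset.sum_comm, one_div_mul_one_div_rev_assoc]
  rfl
where
  one_div_mul_one_div_rev_assoc {a b c : ℝ} : 1 / (a * b) * c = 1 / b * (1 / a * c) := by
    rw [← mul_assoc, one_div_mul_one_div, mul_comm b]

omit [DecidableEq S] in
theorem occupation_budget (M : WCMDP S A K N) {α : Fin K → ℝ} {π : SysPolicy S A N}
    {s₀ : Fin N → S} (hπ : M.IsAdmissible α π s₀) (hN : 0 < N) {T : ℕ} (hT : 0 < T) (k : Fin K) :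
    1 / (N : ℝ) * ∑ i, ∑ s, ∑ a, M.occupation π s₀ T i s a * M.cost k i s a ≤ α k := by
  simp_rw [sum_occupation_mul, ← Finset.mul_sum]
  rw [Finset.sum_comm]
  simp_rw [← pmfExp_sum]
  have h : ∑ t ∈ Finset.range T, pmfExp (M.stateActionLaw π s₀ t)
      (fun x => ∑ i, M.cost k i (x.1 i) (x.2 i)) ≤ ∑ t ∈ Finset.range T, α k * N :=
    Finset.sum_le_sum fun t _ => pmfExp_le_of_support _ fun x hx => hπ t x hx k
  rw [Finset.sum_const, Finset.card_range, nsmul_eq_mul] at h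
  have hN' : (0 : ℝ) < N := by exact_mod_cast hN
  have hT' : (0 : ℝ) < T := by exact_mod_cast hT
  calc _ ≤ 1 / (N : ℝ) * (1 / (T : ℝ) * (T * (α k * N))) := by gcongr
    _ = α k := by field_simp

/-- The two terms average the probability of `s` over the times `1, …, T` and `0, …, T - 1`. Their
difference telescopes to two boundary terms. -/
theorem occupation_stationary (M : WCMDP S A K N) (π : SysPolicy S A N) (s₀ : Fin N → S)
    (T : ℕ) (i : Fin N) (s : S) :
    |∑ s', ∑ a', (M.trans i s' a' s).toReal * M.occupation π s₀ T i s' a'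
      - ∑ a, M.occupation π s₀ T i s a| ≤ 1 / (T : ℝ) := by
  let F : (Fin N → S) → ℝ := fun x => if x i = s then 1 else 0
  have h1 : ∑ s', ∑ a', (M.trans i s' a' s).toReal * M.occupation π s₀ T i s' a' =
      1 / (T : ℝ) * ∑ t ∈ Finset.range T, pmfExp (M.stateLaw π s₀ (t + 1)) F := by
    simp_rw [mul_comm (M.trans i _ _ s).toReal, sum_occupation_mul, pmfExp_stateLaw_succ]
    refine congrArg _ (Finset.sum_congr rfl fun t _ => congrArg _ (funext fun x => ?_))
    rw [sysTrans, pmfExp_indepProd_coord (fun i => M.trans i (x.1 i) (x.2 i)) i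
      (fun s' => if s' = s then 1 else 0)]
    simp [pmfExp]
  have h2 : ∑ a, M.occupation π s₀ T i s a =
      1 / (T : ℝ) * ∑ t ∈ Finset.range T, pmfExp (M.stateLaw π s₀ t) F := by
    simp_rw [pmfExp_stateLaw]
    refine Eq.trans ?_ (M.sum_occupation_mul π s₀ T i fun s' _ => if s' = s then 1 else 0)
    simp_rw [← Finset.sum_mul, mul_ite, mul_one, mul_zero]
    simp
  rw [h1, h2, ← mul_sub, ← Finset.sum_sub_distrib,
    Finset.sum_range_sub (fun t => pmfExp (M.stateLaw π s₀ t) F), abs_mul,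
    abs_of_nonneg (by positivity)]
  have hF0 : ∀ t, 0 ≤ pmfExp (M.stateLaw π s₀ t) F := fun t =>
    pmfExp_nonneg _ fun x => by simp only [F]; split_ifs <;> norm_num
  have hF1 : ∀ t, pmfExp (M.stateLaw π s₀ t) F ≤ 1 := fun t => by
    rw [← pmfExp_const (M.stateLaw π s₀ t) 1]
    exact pmfExp_mono _ fun x => by simp only [F]; split_ifs <;> norm_num
  refine mul_le_of_le_one_right (by positivity) (abs_le.mpr ⟨?_, ?_⟩)
  · linarith [hF0 T, hF1 0]
  · linarith [hF0 0, hF1 T]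

omit [DecidableEq S] in
theorem abs_expReward_le (M : WCMDP S A K N) {R : ℝ} (hR : ∀ i s a, |M.reward i s a| ≤ R)
    (π : SysPolicy S A N) (s₀ : Fin N → S) (t : ℕ) (i : Fin N) :
    |M.expReward π s₀ t i| ≤ R :=
  abs_pmfExp_le _ fun _ => hR _ _ _

omit [DecidableEq S] in
theorem neg_le_avgReward (M : WCMDP S A K N) {R : ℝ} (hR : ∀ i s a, |M.reward i s a| ≤ R)
    (hN : 0 < N) (π : SysPolicy S A N) (s₀ : Fin N → S) {T : ℕ} (hT : 0 < T) :
    -R ≤ M.avgReward π s₀ T := by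
  have h : ∑ t ∈ Finset.range T, ∑ i : Fin N, -R ≤
      ∑ t ∈ Finset.range T, ∑ i, M.expReward π s₀ t i :=
    Finset.sum_le_sum fun t _ => Finset.sum_le_sum fun i _ =>
      (abs_le.mp (M.abs_expReward_le hR π s₀ t i)).1
  simp only [Finset.sum_const, Finset.card_univ, Finset.card_range, Fintype.card_fin,
    nsmul_eq_mul] at h
  have hN' : (0 : ℝ) < N := by exact_mod_cast hN
  have hT' : (0 : ℝ) < T := by exact_mod_cast hT
  calc -R = 1 / ((T : ℝ) * N) * (T * (N * -R)) := by field_simp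
    _ ≤ _ := mul_le_mul_of_nonneg_left h (by positivity)

/-- The occupation frequencies stay in a compact cube, and the stationarity defect vanishes in the
limit. A subsequential limit is thus LP feasible, and the liminf is at most the limit of the rewards
along that subsequence. -/
theorem liminfReward_le_lpObjective (M : WCMDP S A K N) {R : ℝ}
    (hR : ∀ i s a, |M.reward i s a| ≤ R) (hN : 0 < N) {α : Fin K → ℝ} {y : Fin N → S → A → ℝ}
    (hy : M.IsLPOptimal α y) {π : SysPolicy S A N} {s₀ : Fin N → S}
    (hπ : M.IsAdmissible α π s₀) : M.liminfReward π s₀ ≤ M.lpObjective y := by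
  have hmem : ∀ n : ℕ, M.occupation π s₀ (n + 1) ∈
      Set.Icc (fun _ _ _ => 0 : Fin N → S → A → ℝ) (fun _ _ _ => 1) := fun n => by
    refine ⟨fun i s a => M.occupation_nonneg π s₀ _ i s a, fun i s a => ?_⟩
    rw [← M.sum_occupation π s₀ n.succ_pos i]
    exact (Finset.single_le_sum (f := fun a => M.occupation π s₀ (n + 1) i s a)
      (fun a _ => M.occupation_nonneg π s₀ _ i s a) (Finset.mem_univ a)).trans
      (Finset.single_le_sum (f := fun s => ∑ a, M.occupation π s₀ (n + 1) i s a)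
        (fun s _ => Finset.sum_nonneg fun a _ => M.occupation_nonneg π s₀ _ i s a)
        (Finset.mem_univ s))
  obtain ⟨z, -, φ, hφ, hz⟩ := isCompact_Icc.tendsto_subseq hmem
  have hz' : ∀ i s a, Filter.Tendsto (fun n => M.occupation π s₀ (φ n + 1) i s a) Filter.atTop
      (nhds (z i s a)) := fun i s a =>
    tendsto_pi_nhds.mp (tendsto_pi_nhds.mp (tendsto_pi_nhds.mp hz i) s) a
  have hfeas : M.IsLPFeasible α z := by
    refine ⟨fun k => ?_, fun i s => ?_, fun i => ?_, fun i s a => ?_⟩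
    · refine le_of_tendsto' (Filter.Tendsto.const_mul _ (tendsto_finsetSum _ fun i _ =>
        tendsto_finsetSum _ fun s _ => tendsto_finsetSum _ fun a _ => (hz' i s a).mul_const _))
        fun n => M.occupation_budget hπ hN (φ n).succ_pos k
    · have h1 : Filter.Tendsto (fun n => |∑ s', ∑ a', (M.trans i s' a' s).toReal *
          M.occupation π s₀ (φ n + 1) i s' a' - ∑ a, M.occupation π s₀ (φ n + 1) i s a|)
          Filter.atTop (nhds |∑ s', ∑ a', (M.trans i s' a' s).toReal * z i s' a'
            - ∑ a, z i s a|) :=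
        ((tendsto_finsetSum _ fun s' _ => tendsto_finsetSum _ fun a' _ =>
          (hz' i s' a').const_mul _).sub (tendsto_finsetSum _ fun a _ => hz' i s a)).abs
      have h2 : Filter.Tendsto (fun n => 1 / ((φ n : ℝ) + 1)) Filter.atTop (nhds 0) :=
        tendsto_one_div_add_atTop_nhds_zero_nat.comp hφ.tendsto_atTop
      have h3 := le_of_tendsto_of_tendsto' h1 h2 fun n => by
        have := M.occupation_stationary π s₀ (φ n + 1) i s
        push_cast at this
        exact this
      exact sub_eq_zero.mp (abs_nonpos_iff.mp h3)
    · refine tendsto_nhds_unique (tendsto_finsetSum _ fun s _ => tendsto_finsetSum _ fun a _ =>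
        hz' i s a) ?_
      simp_rw [fun n => M.sum_occupation π s₀ (φ n).succ_pos i]
      exact tendsto_const_nhds
    · exact ge_of_tendsto' (hz' i s a) fun n => M.occupation_nonneg π s₀ _ i s a
  refine le_trans ?_ (hy.optimal z hfeas)
  have hobj : Filter.Tendsto (fun n => M.avgReward π s₀ (φ n + 1)) Filter.atTop
      (nhds (M.lpObjective z)) := by
    simp_rw [avgReward_eq_lpObjective]
    exact Filter.Tendsto.const_mul _ (tendsto_finsetSum _ fun i _ =>
      tendsto_finsetSum _ fun s _ => tendsto_finsetSum _ fun a _ => (hz' i s a).mul_const _)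
  -- A real `liminf` is meaningful only for a sequence that is bounded below; `-R` is such a bound
  -- from `T = 1` on.
  refine Filter.liminf_le_of_le ⟨-R, ?_⟩ fun b hb => ge_of_tendsto hobj ?_
  · exact Filter.eventually_map.mpr (Filter.eventually_atTop.mpr
      ⟨1, fun T hT => M.neg_le_avgReward hR hN π s₀ hT⟩)
  · exact ((Filter.tendsto_add_atTop_nat 1).comp hφ.tendsto_atTop).eventually hb

omit [Fintype A] [DecidableEq S] in
-- This makes the set of values in `optValue` nonempty, as bounding a real supremum by `csSup_le`
-- requires.
theorem isAdmissible_idle (M : WCMDP S A K N) {α : Fin K → ℝ} (hα : ∀ k, 0 < α k)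
    (s₀ : Fin N → S) : M.IsAdmissible α (fun _ _ => PMF.pure fun _ => M.idle) s₀ := by
  intro t x hx k
  rw [stateActionLaw, PMF.mem_support_bind_iff] at hx
  obtain ⟨hs, -, hx⟩ := hx
  rw [PMF.pure_map, PMF.mem_support_pure_iff] at hx
  subst hx
  simp only [M.cost_idle, Finset.sum_const_zero]
  exact mul_nonneg (hα k).le (Nat.cast_nonneg N)

theorem optValue_le_lpObjective (M : WCMDP S A K N) {R : ℝ}
    (hR : ∀ i s a, |M.reward i s a| ≤ R) (hN : 0 < N) {α : Fin K → ℝ} (hα : ∀ k, 0 < α k)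
    {y : Fin N → S → A → ℝ} (hy : M.IsLPOptimal α y) (s₀ : Fin N → S) :
    M.optValue α s₀ ≤ M.lpObjective y := by
  refine csSup_le ⟨_, _, M.isAdmissible_idle hα s₀, rfl⟩ ?_
  rintro _ ⟨π, hπ, rfl⟩
  exact M.liminfReward_le_lpObjective hR hN hy hπ

end WCMDP

/-! ### Geometric decay for chains with bounded mixing time -/

section Decay

variable {S : Type*} [Fintype S] [DecidableEq S]

/-- `P` is a stochastic matrix with stationary distribution `μ`. -/
structure IsStationaryDist (P : Matrix S S ℝ) (μ : S → ℝ) : Prop where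
  nonneg : ∀ s s', 0 ≤ P s s'
  row_sum : ∀ s, ∑ s', P s s' = 1
  dist_nonneg : ∀ s, 0 ≤ μ s
  dist_sum : ∑ s, μ s = 1
  stationary : ∀ s', ∑ s, μ s * P s s' = μ s'

namespace IsStationaryDist

variable {P : Matrix S S ℝ} {μ : S → ℝ}

/-- A stochastic matrix contracts the `ℓ¹` norm and fixes `μ`. -/
theorem rowDist_succ_le (h : IsStationaryDist P μ) (s : S) (t : ℕ) :
    ∑ s', |(P ^ (t + 1)) s s' - μ s'| ≤ ∑ s', |(P ^ t) s s' - μ s'| := by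
  have h1 : ∀ s', (P ^ (t + 1)) s s' - μ s' = ∑ u, ((P ^ t) s u - μ u) * P u s' := fun s' => by
    simp_rw [sub_mul, Finset.sum_sub_distrib, h.stationary, pow_succ, Matrix.mul_apply]
  calc ∑ s', |(P ^ (t + 1)) s s' - μ s'|
      ≤ ∑ s', ∑ u, |(P ^ t) s u - μ u| * P u s' := Finset.sum_le_sum fun s' _ => by
        rw [h1]
        refine (Finset.abs_sum_le_sum_abs _ _).trans (Finset.sum_le_sum fun u _ => ?_)
        rw [abs_mul, abs_of_nonneg (h.nonneg u s')]
    _ = ∑ s', |(P ^ t) s s' - μ s'| := by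
        rw [Finset.sum_comm]
        simp_rw [← Finset.mul_sum, h.row_sum, mul_one]

theorem rowDist_le_of_chainMixingTime_le (h : IsStationaryDist P μ) {n : ℕ}
    (hn : chainMixingTime P μ ≤ n) (s : S) :
    ∑ s', |(P ^ n) s s' - μ s'| ≤ 1 / Real.exp 1 := by
  have h1 := (le_iSup (fun s : S => ⨅ (t : ℕ)
    (_ : ∑ s', |(P ^ t) s s' - μ s'| ≤ 1 / Real.exp 1), (t : ℕ∞)) s).trans hn
  obtain ⟨t, ht, htn⟩ : ∃ t : ℕ, ∑ s', |(P ^ t) s s' - μ s'| ≤ 1 / Real.exp 1 ∧ t ≤ n := by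
    -- If no time up to `n` worked, the infimum in `ℕ∞` would be at least `n + 1`.
    by_contra! hcon
    have h2 : ((n + 1 : ℕ) : ℕ∞) ≤ ⨅ (t : ℕ)
        (_ : ∑ s', |(P ^ t) s s' - μ s'| ≤ 1 / Real.exp 1), (t : ℕ∞) :=
      le_iInf₂ fun t ht => by exact_mod_cast hcon t ht
    have h3 : n + 1 ≤ n := by exact_mod_cast h2.trans h1
    omega
  exact (antitone_nat_of_succ_le (f := fun t => ∑ s', |(P ^ t) s s' - μ s'|)
    (h.rowDist_succ_le s) htn).trans ht

omit [DecidableEq S] in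
theorem sum_mul_mulVec (h : IsStationaryDist P μ) (f : S → ℝ) :
    ∑ s, μ s * P.mulVec f s = ∑ s, μ s * f s := by
  simp_rw [Matrix.mulVec, dotProduct, Finset.mul_sum]
  rw [Finset.sum_comm]
  simp_rw [← mul_assoc, ← Finset.sum_mul, h.stationary]

omit [DecidableEq S] in
theorem abs_mulVec_le (h : IsStationaryDist P μ) {f : S → ℝ} {b : ℝ} (hf : ∀ s, |f s| ≤ b)
    (s : S) : |P.mulVec f s| ≤ b := by
  calc |P.mulVec f s| ≤ ∑ s', P s s' * b := by
        refine (Finset.abs_sum_le_sum_abs _ _).trans (Finset.sum_le_sum fun u _ => ?_)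
        rw [abs_mul, abs_of_nonneg (h.nonneg s u)]
        exact mul_le_mul_of_nonneg_left (hf u) (h.nonneg s u)
    _ = b := by rw [← Finset.sum_mul, h.row_sum, one_mul]

end IsStationaryDist

/-- The centred function `g`, pushed forward `l` steps by the chain `P`. -/
noncomputable def chainFeature (P : Matrix S S ℝ) (μ g : S → ℝ) (l : ℕ) : S → ℝ :=
  (P ^ l).mulVec fun s => g s - ∑ s', μ s' * g s'

theorem chainFeature_zero (P : Matrix S S ℝ) (μ g : S → ℝ) (s : S) :
    chainFeature P μ g 0 s = g s - ∑ s', μ s' * g s' := by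
  simp [chainFeature]

theorem mulVec_chainFeature (P : Matrix S S ℝ) (μ g : S → ℝ) (l : ℕ) :
    P.mulVec (chainFeature P μ g l) = chainFeature P μ g (l + 1) := by
  rw [chainFeature, chainFeature, Matrix.mulVec_mulVec, pow_succ']

theorem pow_mulVec_chainFeature (P : Matrix S S ℝ) (μ g : S → ℝ) (n l : ℕ) :
    (P ^ n).mulVec (chainFeature P μ g l) = chainFeature P μ g (n + l) := by
  rw [chainFeature, chainFeature, Matrix.mulVec_mulVec, pow_add]

namespace IsStationaryDist

variable {P : Matrix S S ℝ} {μ : S → ℝ}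

theorem sum_mul_chainFeature (h : IsStationaryDist P μ) (g : S → ℝ) (l : ℕ) :
    ∑ s, μ s * chainFeature P μ g l s = 0 := by
  induction l with
  | zero =>
    simp_rw [chainFeature_zero, mul_sub, Finset.sum_sub_distrib, ← Finset.sum_mul, h.dist_sum]
    simp
  | succ l ih => rw [← mulVec_chainFeature, h.sum_mul_mulVec, ih]

/-- The feature has mean zero under `μ`, so `μ` may be subtracted from each row of `P ^ n`; what is
left has `ℓ¹` norm at most `1 / e`. -/
theorem abs_chainFeature_add_le (h : IsStationaryDist P μ) (g : S → ℝ) {n : ℕ}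
    (hn : chainMixingTime P μ ≤ n) {l : ℕ} {b : ℝ} (hb : ∀ s, |chainFeature P μ g l s| ≤ b)
    (hb0 : 0 ≤ b) (s : S) : |chainFeature P μ g (n + l) s| ≤ Real.exp (-1) * b := by
  have h1 : chainFeature P μ g (n + l) s =
      ∑ s', ((P ^ n) s s' - μ s') * chainFeature P μ g l s' := by
    simp_rw [sub_mul, Finset.sum_sub_distrib, h.sum_mul_chainFeature, sub_zero,
      ← pow_mulVec_chainFeature]
    rfl
  calc |chainFeature P μ g (n + l) s| ≤ ∑ s', |(P ^ n) s s' - μ s'| * b := by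
        rw [h1]
        refine (Finset.abs_sum_le_sum_abs _ _).trans (Finset.sum_le_sum fun u _ => ?_)
        rw [abs_mul]
        exact mul_le_mul_of_nonneg_left (hb u) (abs_nonneg _)
    _ ≤ Real.exp (-1) * b := by
        rw [← Finset.sum_mul, Real.exp_neg, ← one_div]
        exact mul_le_mul_of_nonneg_right (h.rowDist_le_of_chainMixingTime_le hn s) hb0

/-- Every block of `n` steps gains a factor `1 / e`; the incomplete last block costs the factor
`Real.exp 1`. The exponent `2 * l` is there so that half of the decay can be traded for the weights
of `featureNorm`. -/
theorem abs_chainFeature_le (h : IsStationaryDist P μ) {g : S → ℝ} {G : ℝ}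
    (hg : ∀ s, |g s| ≤ G) {n : ℕ} (hn0 : 0 < n) (hn : chainMixingTime P μ ≤ n) (l : ℕ) (s : S) :
    |chainFeature P μ g l s| ≤ 2 * G * Real.exp 1 * Real.exp (-1 / (2 * n)) ^ (2 * l) := by
  have hG : 0 ≤ G := (abs_nonneg _).trans (hg s)
  have hμ : |∑ s', μ s' * g s'| ≤ G := by
    calc |∑ s', μ s' * g s'| ≤ ∑ s', μ s' * G := by
          refine (Finset.abs_sum_le_sum_abs _ _).trans (Finset.sum_le_sum fun u _ => ?_)
          rw [abs_mul, abs_of_nonneg (h.dist_nonneg u)]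
          exact mul_le_mul_of_nonneg_left (hg u) (h.dist_nonneg u)
      _ = G := by rw [← Finset.sum_mul, h.dist_sum, one_mul]
  have h0 : ∀ l s, |chainFeature P μ g l s| ≤ 2 * G := by
    intro l
    induction l with
    | zero =>
      intro s
      rw [chainFeature_zero]
      exact (abs_sub _ _).trans (by linarith [hg s])
    | succ l ih =>
      rw [← mulVec_chainFeature]
      exact h.abs_mulVec_le ih
  have h1 : ∀ q l s, |chainFeature P μ g (n * q + l) s| ≤ Real.exp (-1) ^ q * (2 * G) := by
    intro q l
    induction q with
    | zero => simpa using h0 l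
    | succ q ih =>
      intro s
      rw [mul_add, mul_one, add_comm _ n, add_assoc, pow_succ', mul_assoc]
      exact h.abs_chainFeature_add_le g hn ih (by positivity) s
  rw [← Nat.div_add_mod l n]
  refine (h1 _ _ s).trans ?_
  rw [Nat.div_add_mod l n, ← Real.exp_nat_mul, ← Real.exp_nat_mul, mul_assoc (2 * G),
    ← Real.exp_add, mul_comm]
  refine mul_le_mul_of_nonneg_left (Real.exp_le_exp.mpr ?_) (by positivity)
  have hnr : (0 : ℝ) < n := by exact_mod_cast hn0
  have h2 : (l : ℝ) ≤ n * ((l / n : ℕ) + 1) := by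
    exact_mod_cast (Nat.lt_mul_div_succ l hn0).le
  have h3 : (l : ℝ) / n ≤ (l / n : ℕ) + 1 := by rwa [div_le_iff₀' hnr]
  have h4 : ((2 * l : ℕ) : ℝ) * (-1 / (2 * n)) = -(l / n) := by
    push_cast
    field_simp
  rw [h4]
  linarith

end IsStationaryDist

end Decay

/-! ### The chain of a single-armed policy -/

namespace WCMDP

variable {S A : Type*} [Fintype S] [Fintype A] [DecidableEq S] {K N : ℕ}

omit [Fintype S] [DecidableEq S] in
theorem toReal_singleArmPolicy [Nonempty A] (y : Fin N → S → A → ℝ) (hy : ∀ i s a, 0 ≤ y i s a)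
    (i : Fin N) (s : S) (a : A) :
    (singleArmPolicy y hy i s a).toReal = singleArmProb y i s a := by
  rw [singleArmPolicy, PMF.ofFintype_apply, ENNReal.toReal_ofReal]
  unfold singleArmProb
  split_ifs with h
  · exact div_nonneg (hy i s a) h.le
  · positivity

omit [Fintype S] [DecidableEq S] in
-- In a state without mass all `y i s a` vanish, so the default value `1 / |A|` is harmless.
theorem stateDist_mul_singleArmProb {y : Fin N → S → A → ℝ} (hy : ∀ i s a, 0 ≤ y i s a)
    (i : Fin N) (s : S) (a : A) : stateDist y i s * singleArmProb y i s a = y i s a := by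
  unfold stateDist singleArmProb
  split_ifs with h
  · rw [mul_div_cancel₀ _ h.ne']
  · have h0 : ∑ a, y i s a = 0 := le_antisymm (not_lt.mp h) (Finset.sum_nonneg fun a _ => hy i s a)
    rw [h0, zero_mul, (Finset.sum_eq_zero_iff_of_nonneg fun a _ => hy i s a).mp h0 a
      (Finset.mem_univ a)]

/-- The mean of `g` in each state under the single-armed policy of arm `i`. -/
noncomputable def policyMean [Nonempty A] (y : Fin N → S → A → ℝ) (hy : ∀ i s a, 0 ≤ y i s a)
    (i : Fin N) (g : S → A → ℝ) (s : S) : ℝ :=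
  pmfExp (singleArmPolicy y hy i s) (g s)

omit [DecidableEq S] in
theorem sum_stateDist_mul_policyMean [Nonempty A] (y : Fin N → S → A → ℝ)
    (hy : ∀ i s a, 0 ≤ y i s a) (i : Fin N) (g : S → A → ℝ) :
    ∑ s, stateDist y i s * policyMean y hy i g s = ∑ s, ∑ a, y i s a * g s a := by
  simp_rw [policyMean, pmfExp, Finset.mul_sum, toReal_singleArmPolicy, ← mul_assoc,
    stateDist_mul_singleArmProb hy]

omit [DecidableEq S] in
theorem policyMean_pmfExp_trans [Nonempty A] (M : WCMDP S A K N) (y : Fin N → S → A → ℝ)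
    (hy : ∀ i s a, 0 ≤ y i s a) (i : Fin N) (f : S → ℝ) (s : S) :
    policyMean y hy i (fun s a => pmfExp (M.trans i s a) f) s
      = (M.inducedChain y i).mulVec f s := by
  simp_rw [policyMean, pmfExp, toReal_singleArmPolicy, Matrix.mulVec, dotProduct, inducedChain,
    Matrix.of_apply, Finset.mul_sum, Finset.sum_mul]
  rw [Finset.sum_comm]
  exact Finset.sum_congr rfl fun _ _ => Finset.sum_congr rfl fun _ _ => by ring

omit [DecidableEq S] in
theorem IsLPFeasible.isStationaryDist [Nonempty A] {M : WCMDP S A K N} {α : Fin K → ℝ}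
    {y : Fin N → S → A → ℝ} (h : M.IsLPFeasible α y) (i : Fin N) :
    IsStationaryDist (M.inducedChain y i) (stateDist y i) where
  nonneg s s' := Finset.sum_nonneg fun a _ => by
    rw [← toReal_singleArmPolicy y h.nonneg]
    positivity
  row_sum s := by
    have h1 := M.policyMean_pmfExp_trans y h.nonneg i (fun _ => 1) s
    simp_rw [policyMean, pmfExp_const, Matrix.mulVec, dotProduct, mul_one] at h1
    exact h1.symm
  dist_nonneg s := Finset.sum_nonneg fun a _ => h.nonneg i s a
  dist_sum := h.total i
  stationary s' := by
    rw [stateDist, ← h.stationary]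
    simp_rw [inducedChain, Matrix.of_apply, Finset.mul_sum, mul_left_comm (stateDist y i _),
      stateDist_mul_singleArmProb h.nonneg]

end WCMDP

/-! ### Budget slack after the ID reassignment -/

namespace ReassignState

variable {K N : ℕ} {C : Fin K → Fin N → ℝ} {δ : ℝ}

/-- The candidates have no new ID yet, and a large cost. -/
def CandInv (C : Fin K → Fin N → ℝ) (δ : ℝ) (st : ReassignState K N) : Prop :=
  ∀ k i, i ∈ st.cand k → st.newID i = none ∧ δ ≤ C k i

theorem segmentSum_le_assign {c : Fin N → ℝ} (hc : ∀ i, 0 ≤ c i) (st : ReassignState K N)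
    {i : Fin N} (hi : st.newID i = none) (lo hi' : ℕ) :
    st.segmentSum c lo hi' ≤ (st.assign i).segmentSum c lo hi' := by
  classical
  refine Finset.sum_le_sum_of_subset_of_nonneg (fun j hj => ?_) fun j _ _ => hc j
  simp only [Finset.mem_filter, Finset.mem_univ, true_and] at hj ⊢
  obtain ⟨p, hp, hlo⟩ := hj
  refine ⟨p, ?_, hlo⟩
  refine (Function.update_of_ne ?_ _ _).trans hp
  rintro rfl
  rw [hi] at hp
  cases hp

theorem le_segmentSum_assign {c : Fin N → ℝ} (hc : ∀ i, 0 ≤ c i) (st : ReassignState K N)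
    (i : Fin N) {lo hi : ℕ} (h1 : lo ≤ st.next) (h2 : st.next < hi) :
    c i ≤ (st.assign i).segmentSum c lo hi := by
  classical
  refine Finset.single_le_sum (fun j _ => hc j) ?_
  simp only [Finset.mem_filter, Finset.mem_univ, true_and]
  exact ⟨st.next, by simp [assign], h1, h2⟩

theorem CandInv.assign {st : ReassignState K N} (h : CandInv C δ st) (i : Fin N) :
    CandInv C δ (st.assign i) := by
  intro k j hj
  obtain ⟨hj1, hj2⟩ := hj
  obtain ⟨h1, h2⟩ := h k j hj1
  exact ⟨(Function.update_of_ne hj2 _ _).trans h1, h2⟩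

/-- The pass for `k` either finds enough cost in the group or adds a candidate, whose cost alone
reaches `δ`. Later passes only add nonnegative costs. The bound `hhi` keeps the IDs given out inside
the group. -/
theorem InnerLoop.spec (hC : ∀ k i, 0 ≤ C k i) {lo hi : ℕ} {ks : List (Fin K)}
    {st st' : ReassignState K N} (h : InnerLoop C δ lo hi ks st st') (hinv : CandInv C δ st)
    (hlo : lo ≤ st.next) (hhi : st.next + ks.length ≤ hi) :
    CandInv C δ st' ∧ (∀ k a b, st.segmentSum (C k) a b ≤ st'.segmentSum (C k) a b) ∧
      ∀ k ∈ ks, δ ≤ st'.segmentSum (C k) lo hi := by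
  induction h with
  | nil st => exact ⟨hinv, fun _ _ _ => le_rfl, by simp⟩
  | cons k ks st st₁ st₂ h₁ _ ih =>
    rw [List.length_cons] at hhi
    have hstep : CandInv C δ st₁ ∧ (∀ k a b, st.segmentSum (C k) a b ≤ st₁.segmentSum (C k) a b) ∧
        δ ≤ st₁.segmentSum (C k) lo hi ∧ lo ≤ st₁.next ∧ st₁.next ≤ st.next + 1 := by
      cases h₁ with
      | skip h => exact ⟨hinv, fun _ _ _ => le_rfl, h, hlo, by omega⟩
      | pick i _ hmem =>
        obtain ⟨g1, g2⟩ := hinv k i hmem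
        refine ⟨hinv.assign i, fun k a b => segmentSum_le_assign (hC k) st g1 a b,
          g2.trans (le_segmentSum_assign (hC k) st i hlo (by omega)), ?_, le_rfl⟩
        simp only [ReassignState.assign]
        omega
    obtain ⟨a1, a2, a3, a4, a5⟩ := hstep
    obtain ⟨b1, b2, b3⟩ := ih a1 a4 (by omega)
    refine ⟨b1, fun k a b => (a2 k a b).trans (b2 k a b), fun k' hk' => ?_⟩
    rcases List.mem_cons.mp hk' with rfl | hk'
    · exact a3.trans (b2 _ _ _)
    · exact b3 k' hk'

theorem OuterLoop.spec (hC : ∀ k i, 0 ≤ C k i) {d l : ℕ} (hd : K ≤ d) {act : Set (Fin K)}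
    {st : ReassignState K N} (h : OuterLoop C δ d act l st) :
    CandInv C δ st ∧
      ∀ l' < l, ∀ k ∈ act, δ ≤ st.segmentSum (C k) (l' * d) ((l' + 1) * d) := by
  induction h with
  | zero => exact ⟨fun k i hi => ⟨rfl, hi⟩, fun l' hl' => absurd hl' (Nat.not_lt_zero _)⟩
  | succ l st st' ks _ hnodup hks hloop ih =>
    have hlen : ks.length ≤ K := by simpa using hnodup.length_le_card
    obtain ⟨g1, g2, g3⟩ := hloop.spec hC ih.1 le_rfl (by
      simp only
      rw [add_mul, one_mul]
      omega)
    refine ⟨g1, fun l' hl' k hk => ?_⟩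
    rcases Nat.lt_succ_iff_lt_or_eq.mp hl' with hl' | rfl
    · exact (ih.2 l' hl' k hk).trans (g2 k _ _)
    · exact g3 k ((hks k).mpr hk)

end ReassignState

/-- The rate at which the leading arms leave budget slack to the others. -/
noncomputable def slackRate {K : ℕ} (α : Fin K → ℝ) (cmax : ℝ) : ℝ :=
  -- The first entry serves the inactive constraints, the second the active ones. The `+ 1` keeps
  -- the rate positive when the group size is zero.
  min ((⨅ k, α k) / 2) (reassignThreshold α / (reassignGroupSize α cmax + 1))

theorem iInf_budget_pos {K : ℕ} (hK : 0 < K) {α : Fin K → ℝ} (hα : ∀ k, 0 < α k) :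
    0 < ⨅ k, α k := by
  have : Nonempty (Fin K) := ⟨⟨0, hK⟩⟩
  obtain ⟨k, hk⟩ := exists_eq_ciInf_of_finite (f := α)
  rw [← hk]
  exact hα k

theorem reassignThreshold_pos {K : ℕ} (hK : 0 < K) {α : Fin K → ℝ} (hα : ∀ k, 0 < α k) :
    0 < reassignThreshold α :=
  div_pos (iInf_budget_pos hK hα) four_pos

theorem slackRate_pos {K : ℕ} (hK : 0 < K) {α : Fin K → ℝ} (hα : ∀ k, 0 < α k) (cmax : ℝ) :
    0 < slackRate α cmax :=
  lt_min (half_pos (iInf_budget_pos hK hα))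
    (div_pos (reassignThreshold_pos hK hα) (by positivity))

namespace WCMDP

variable {S A : Type*} [Fintype S] [Fintype A] {K N : ℕ}

theorem expCost_nonneg (M : WCMDP S A K N) {y : Fin N → S → A → ℝ} (hy : ∀ i s a, 0 ≤ y i s a)
    (k : Fin K) (i : Fin N) : 0 ≤ M.expCost y k i :=
  Finset.sum_nonneg fun s _ => Finset.sum_nonneg fun a _ =>
    mul_nonneg (hy i s a) (M.cost_nonneg k i s a)

theorem IsLPFeasible.expCost_le {M : WCMDP S A K N} {α : Fin K → ℝ} {y : Fin N → S → A → ℝ}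
    (hy : M.IsLPFeasible α y) {cmax : ℝ} (hc : ∀ k i s a, M.cost k i s a ≤ cmax) (k : Fin K)
    (i : Fin N) : M.expCost y k i ≤ cmax := by
  calc M.expCost y k i ≤ ∑ s, ∑ a, y i s a * cmax :=
        Finset.sum_le_sum fun s _ => Finset.sum_le_sum fun a _ =>
          mul_le_mul_of_nonneg_left (hc k i s a) (hy.nonneg i s a)
    _ = cmax := by simp_rw [← Finset.sum_mul]; rw [hy.total i, one_mul]

theorem IsLPFeasible.sum_expCost_le {M : WCMDP S A K N} {α : Fin K → ℝ} {y : Fin N → S → A → ℝ}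
    (hy : M.IsLPFeasible α y) (hN : 0 < N) (k : Fin K) : ∑ i, M.expCost y k i ≤ α k * N := by
  have h := hy.budget k
  have hN' : (0 : ℝ) < N := by exact_mod_cast hN
  rwa [one_div, inv_mul_le_iff₀ hN', mul_comm] at h

/-- An active constraint forces `cmax` to be at least half the smallest `α k`, so the factor of `K`
in the group size is at least one. Hence a group has room for one arm per constraint. -/
theorem IsLPFeasible.card_le_reassignGroupSize {M : WCMDP S A K N} (hN : 0 < N)
    {α : Fin K → ℝ} (hα : ∀ k, 0 < α k) {cmax : ℝ} (hc : ∀ k i s a, M.cost k i s a ≤ cmax)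
    {y : Fin N → S → A → ℝ} (hy : M.IsLPFeasible α y) (hact : (M.activeSet α y).Nonempty) :
    K ≤ reassignGroupSize α cmax := by
  obtain ⟨k₀, hk₀⟩ := hact
  set am := ⨅ k, α k with ham
  have hδ' : reassignThreshold α = am / 4 := rfl
  have ham_pos : 0 < am := iInf_budget_pos k₀.pos hα
  have hNr : (0 : ℝ) < N := by exact_mod_cast hN
  have h1 : α k₀ / 2 * N ≤ cmax * N := by
    refine le_trans (show α k₀ / 2 * N ≤ ∑ i, M.expCost y k₀ i from hk₀) ?_
    refine (Finset.sum_le_sum fun i _ => hy.expCost_le hc k₀ i).trans ?_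
    simp [mul_comm]
  have h2 := le_of_mul_le_mul_right h1 hNr
  have h3 : am ≤ α k₀ := ciInf_le (Finite.bddBelow_range α) k₀
  have h4 : (K : ℝ) ≤ reassignGroupSize α cmax := by
    refine le_trans ?_ (Nat.le_ceil _)
    rw [← ham, hδ', le_div_iff₀ (by linarith), mul_comm]
    exact mul_le_mul_of_nonneg_right (by linarith) (Nat.cast_nonneg K)
  exact_mod_cast h4

theorem psum_mono {c : Fin N → ℝ} (hc : ∀ i, 0 ≤ c i) (σ : Equiv.Perm (Fin N)) {m m' : ℕ}
    (h : m ≤ m') : psum σ m c ≤ psum σ m' c := by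
  refine Finset.sum_le_sum_of_subset_of_nonneg (fun i hi => ?_) fun i _ _ => hc i
  simp only [Finset.mem_filter, Finset.mem_univ, true_and] at hi ⊢
  omega

theorem psum_add_segmentSum_le {c : Fin N → ℝ} (hc : ∀ i, 0 ≤ c i) {σ : Equiv.Perm (Fin N)}
    {st : ReassignState K N} (hst : ∀ i p, st.newID i = some p → ((σ i : Fin N) : ℕ) = p)
    {lo hi : ℕ} (h : lo ≤ hi) : psum σ lo c + st.segmentSum c lo hi ≤ psum σ hi c := by
  classical
  rw [psum, ReassignState.segmentSum, psum, ← Finset.sum_union]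
  · refine Finset.sum_le_sum_of_subset_of_nonneg (fun i hi => ?_) fun i _ _ => hc i
    simp only [Finset.mem_filter, Finset.mem_univ, true_and, Finset.mem_union] at hi ⊢
    rcases hi with hi | ⟨p, hp, hp1, hp2⟩
    · omega
    · have := hst i p hp
      omega
  · rw [Finset.disjoint_filter]
    rintro i - hi ⟨p, hp, hp1, hp2⟩
    have := hst i p hp
    omega

/-- After the reassignment, the cost of the first `N - w` arms leaves a slack proportional
to `w`. -/
theorem psum_expCost_le {M : WCMDP S A K N} (hN : 0 < N) {α : Fin K → ℝ} (hα : ∀ k, 0 < α k)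
    {cmax : ℝ} (hc : ∀ k i s a, M.cost k i s a ≤ cmax) {y : Fin N → S → A → ℝ}
    (hy : M.IsLPFeasible α y) {σ : Equiv.Perm (Fin N)} (hσ : M.IsReassignment α cmax y σ)
    (k : Fin K) {w : ℕ} (hw : w ≤ N) :
    psum σ (N - w) (M.expCost y k) ≤
      α k * N - slackRate α cmax * w + 2 * reassignThreshold α := by
  have hδ := reassignThreshold_pos k.pos hα
  have hC := M.expCost_nonneg hy.nonneg
  have hwN : (w : ℝ) ≤ N := by exact_mod_cast hw
  have hmono : psum σ (N - w) (M.expCost y k) ≤ ∑ i, M.expCost y k i := by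
    rw [← psum_card σ]
    exact psum_mono (hC k) σ (Nat.sub_le _ _)
  by_cases hk : k ∈ M.activeSet α y
  · rcases hσ with ⟨h0, -⟩ | ⟨hne, st, hloop, hst⟩
    · rw [h0] at hk
      exact hk.elim
    have hKd := hy.card_le_reassignGroupSize hN hα hc hne
    set d := reassignGroupSize α cmax with hd
    have hd0 : 0 < d := k.pos.trans_le hKd
    set δ := reassignThreshold α
    obtain ⟨-, hseg⟩ := hloop.spec hC hKd
    -- For an active constraint, every complete group carries cost at least `δ`.
    have hgroups : ∀ q q', q ≤ q' → q' ≤ N / d → psum σ (q * d) (M.expCost y k)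
        + δ * ((q' : ℝ) - q) ≤ psum σ (q' * d) (M.expCost y k) := by
      intro q q' hq
      induction q', hq using Nat.le_induction with
      | base => simp
      | succ n hn ih =>
        intro hn'
        have h1 := ih (by omega)
        have h2 := hseg n (by omega) k hk
        have h3 := psum_add_segmentSum_le (hC k) hst
          (Nat.mul_le_mul_right d (Nat.le_succ n))
        push_cast
        simp only [Nat.succ_eq_add_one] at h3
        linarith
    -- The groups from `q` on start after position `N - w`, so their cost is saved by omitting the
    -- last `w` arms.
    set q := (N - w) / d + 1 with hq
    have hqd : N - w ≤ q * d := by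
      rw [hq, mul_comm]
      exact (Nat.lt_mul_div_succ _ hd0).le
    have htail : psum σ (N - w) (M.expCost y k) + δ * (((N / d : ℕ) : ℝ) - q)
        ≤ ∑ i, M.expCost y k i := by
      rcases le_total q (N / d) with h | h
      · have h1 := hgroups q (N / d) h le_rfl
        have h2 := psum_mono (hC k) σ hqd
        have h3 := psum_mono (hC k) σ (Nat.div_mul_le_self N d)
        rw [psum_card] at h3
        linarith
      · have h1 : ((N / d : ℕ) : ℝ) ≤ q := by exact_mod_cast h
        have := mul_nonneg hδ.le (sub_nonneg.mpr h1)
        linarith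
    have hdr : (0 : ℝ) < d := by exact_mod_cast hd0
    have hQ : (N : ℝ) / d ≤ (N / d : ℕ) + 1 := by
      rw [div_le_iff₀' hdr]
      exact_mod_cast (Nat.lt_mul_div_succ N hd0).le
    have hq' : (q : ℝ) ≤ (N - w) / d + 1 := by
      rw [hq]
      push_cast
      have := Nat.cast_div_le (α := ℝ) (m := N - w) (n := d)
      rw [Nat.cast_sub hw] at this
      linarith
    have hβ : slackRate α cmax * w ≤ δ * (w / d) := by
      have h1 : slackRate α cmax ≤ δ / d :=
        (min_le_right _ _).trans (div_le_div_of_nonneg_left hδ.le hdr (by linarith))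
      calc slackRate α cmax * w ≤ δ / d * w := by gcongr
        _ = δ * (w / d) := by ring
    -- The roundings in `q` and in `N / d` lose at most one group each, whence the additive `2 * δ`.
    have h4 := mul_le_mul_of_nonneg_left
      (show (w : ℝ) / d - 2 ≤ ((N / d : ℕ) : ℝ) - q by rw [sub_div] at hq'; linarith) hδ.le
    have h5 := hy.sum_expCost_le hN k
    linarith
  -- An inactive constraint has half of its budget unused even when all arms count, and this covers
  -- the slack for any `w ≤ N`.
  · have h1 : ∑ i, M.expCost y k i < α k / 2 * N := not_le.mp hk
    have h2 : slackRate α cmax ≤ α k / 2 := (min_le_left _ _).trans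
      (div_le_div_of_nonneg_right (ciInf_le (Finite.bddBelow_range α) k) two_pos.le)
    have h3 : slackRate α cmax * w ≤ α k / 2 * N :=
      mul_le_mul h2 hwN (Nat.cast_nonneg w) (half_pos (hα k)).le
    linarith

end WCMDP

/-! ### Weighted sums of features -/

section FeatureNorm

variable {N : ℕ}

theorem psumMax_le (σ : Equiv.Perm (Fin N)) {b : ℝ} {z : Fin N → ℝ} (hz : ∀ i, |z i| ≤ b)
    (hb : 0 ≤ b) (m : ℕ) : psumMax σ z m ≤ b * m := by
  induction m with
  | zero => simp [psumMax]
  | succ m ih =>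
    refine max_le (ih.trans ?_) ((le_abs_self _).trans (abs_psum_le σ hz hb _))
    push_cast
    linarith

theorem psumSup_le (σ : Equiv.Perm (Fin N)) {b : ℝ} {z : Fin N → ℝ} (hz : ∀ i, |z i| ≤ b)
    (hb : 0 ≤ b) : psumSup σ z ≤ 2 * (b * N) := by
  have h1 := psumMax_le σ hz hb N
  have h2 := psumMax_le σ (z := fun i => -z i) (fun i => by rw [abs_neg]; exact hz i) hb N
  rw [psumSup]
  linarith

/-- The norm, discounted by `γ`, of the partial sums of a sequence of vectors. -/
noncomputable def featureNorm (γ : ℝ) (σ : Equiv.Perm (Fin N)) (m : ℕ) (z : ℕ → Fin N → ℝ) : ℝ :=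
  ∑' l, (γ ^ l)⁻¹ * |psum σ m (z l)|

/-- The discounted sum of the bounds for all partial sums of a sequence of vectors. -/
noncomputable def featureSup (γ : ℝ) (σ : Equiv.Perm (Fin N)) (z : ℕ → Fin N → ℝ) : ℝ :=
  ∑' l, (γ ^ l)⁻¹ * psumSup σ (z l)

variable {γ L : ℝ} (hγ0 : 0 < γ) (hγ1 : γ < 1) {z : ℕ → Fin N → ℝ}
  (hz : ∀ l i, |z l i| ≤ L * γ ^ (2 * l)) (σ : Equiv.Perm (Fin N))

include hγ0 in
theorem inv_pow_mul_pow_two_mul (c : ℝ) (l : ℕ) : (γ ^ l)⁻¹ * (c * γ ^ (2 * l)) = c * γ ^ l := by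
  have : γ ^ l ≠ 0 := (pow_pos hγ0 l).ne'
  rw [two_mul, pow_add]
  field_simp

include hγ0 hγ1 in
theorem summable_of_le_pow_two_mul {c : ℝ} {u : ℕ → ℝ} (h0 : ∀ l, 0 ≤ u l)
    (h : ∀ l, u l ≤ c * γ ^ (2 * l)) : Summable fun l => (γ ^ l)⁻¹ * u l := by
  refine Summable.of_nonneg_of_le (fun l => mul_nonneg (by positivity) (h0 l)) (fun l => ?_)
    ((summable_geometric_of_lt_one hγ0.le hγ1).mul_left c)
  rw [← inv_pow_mul_pow_two_mul hγ0 c l]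
  exact mul_le_mul_of_nonneg_left (h l) (by positivity)

include hγ0 hγ1 in
theorem tsum_le_of_le_pow_two_mul {c : ℝ} {u : ℕ → ℝ} (h0 : ∀ l, 0 ≤ u l)
    (h : ∀ l, u l ≤ c * γ ^ (2 * l)) : ∑' l, (γ ^ l)⁻¹ * u l ≤ c / (1 - γ) := by
  rw [div_eq_mul_inv, ← tsum_geometric_of_lt_one hγ0.le hγ1, ← tsum_mul_left]
  refine (summable_of_le_pow_two_mul hγ0 hγ1 h0 h).tsum_le_tsum (fun l => ?_)
    ((summable_geometric_of_lt_one hγ0.le hγ1).mul_left c)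
  rw [← inv_pow_mul_pow_two_mul hγ0 c l]
  exact mul_le_mul_of_nonneg_left (h l) (by positivity)

include hγ0 hγ1 hz in
theorem summable_featureNorm (hL : 0 ≤ L) (m : ℕ) :
    Summable fun l => (γ ^ l)⁻¹ * |psum σ m (z l)| :=
  summable_of_le_pow_two_mul hγ0 hγ1 (c := L * m) (fun l => abs_nonneg _) fun l => by
    rw [mul_right_comm]
    exact abs_psum_le σ (hz l) (by positivity) m

include hγ0 hγ1 hz in
theorem summable_featureSup (hL : 0 ≤ L) : Summable fun l => (γ ^ l)⁻¹ * psumSup σ (z l) :=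
  summable_of_le_pow_two_mul hγ0 hγ1 (c := 2 * L * N) (fun l => psumSup_nonneg _ _) fun l => by
    refine (psumSup_le σ (hz l) (by positivity)).trans_eq ?_
    ring

include hγ0 in
theorem featureSup_nonneg : 0 ≤ featureSup γ σ z :=
  tsum_nonneg fun l => mul_nonneg (by positivity) (psumSup_nonneg _ _)

theorem featureNorm_zero : featureNorm γ σ 0 z = 0 := by
  simp [featureNorm, psum_zero]

include hγ0 hγ1 hz in
theorem abs_psum_le_featureNorm (hL : 0 ≤ L) (m : ℕ) :
    |psum σ m (z 0)| ≤ featureNorm γ σ m z := by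
  simpa [featureNorm] using (summable_featureNorm hγ0 hγ1 hz σ hL m).le_tsum 0
    fun l _ => mul_nonneg (by positivity) (abs_nonneg _)

include hγ0 hγ1 hz in
-- One more arm adds at most the weighted sum of its feature bounds, the geometric series `∑ L * γ ^
-- l`.
theorem featureNorm_le_add (hL : 0 ≤ L) {m m' : ℕ} (h : m ≤ m') :
    featureNorm γ σ m' z ≤ featureNorm γ σ m z + L / (1 - γ) * (m' - m) := by
  have hm : (0 : ℝ) ≤ m' - m := sub_nonneg.mpr (by exact_mod_cast h)
  have hbd : ∀ l, |psum σ m' (z l) - psum σ m (z l)| ≤ L * (m' - m) * γ ^ (2 * l) := fun l => by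
    rw [mul_right_comm]
    exact abs_psum_sub_psum_le σ (hz l) (by positivity) h
  have h1 := tsum_le_of_le_pow_two_mul hγ0 hγ1 (fun l => abs_nonneg _) hbd
  have h2 := summable_of_le_pow_two_mul hγ0 hγ1 (fun l => abs_nonneg _) hbd
  have h3 := summable_featureNorm hγ0 hγ1 hz σ hL m
  rw [div_mul_eq_mul_div]
  refine le_trans ?_ (add_le_add_right h1 _)
  rw [featureNorm, featureNorm, ← h3.tsum_add h2]
  refine (summable_featureNorm hγ0 hγ1 hz σ hL m').tsum_le_tsum (fun l => ?_) (h3.add h2)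
  rw [← mul_add]
  refine mul_le_mul_of_nonneg_left ?_ (by positivity)
  have := abs_add_le (psum σ m (z l)) (psum σ m' (z l) - psum σ m (z l))
  rwa [add_sub_cancel] at this

include hγ0 hγ1 hz in
/-- Shifting the sequence contracts the norm. -/
theorem featureNorm_shift_le (hL : 0 ≤ L) (m : ℕ) :
    featureNorm γ σ m (fun l => z (l + 1)) ≤ γ * featureNorm γ σ m z := by
  have h := summable_featureNorm hγ0 hγ1 hz σ hL m
  -- The term `l = 0` is dropped; each remaining term reappears with its weight multiplied by `γ`.
  rw [featureNorm, featureNorm, h.tsum_eq_zero_add, mul_add, ← tsum_mul_left]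
  refine le_add_of_nonneg_of_le (by positivity) (le_of_eq (tsum_congr fun l => ?_))
  rw [pow_succ]
  field_simp

include hγ0 hγ1 hz in
-- The recursion is needed only on the prefix, while the noise terms `featureSup` do not depend on
-- `m`. One noise bound thus serves all prefixes, including those whose length depends on the noise.
theorem featureNorm_le_of_noise (hL : 0 ≤ L) (m : ℕ) {z' n₁ n₂ : ℕ → Fin N → ℝ}
    (h1 : ∀ l i, |n₁ l i| ≤ 2 * L * γ ^ (2 * l)) (h2 : ∀ l i, |n₂ l i| ≤ 2 * L * γ ^ (2 * l))
    (hz' : ∀ l i, |z' l i| ≤ L * γ ^ (2 * l))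
    (h : ∀ l i, (σ i : ℕ) < m → z' l i = z (l + 1) i + (n₁ l i + n₂ l i)) :
    featureNorm γ σ m z' ≤
      γ * featureNorm γ σ m z + (featureSup γ σ n₁ + featureSup γ σ n₂) := by
  have hs1 := summable_featureSup hγ0 hγ1 h1 σ (by positivity)
  have hs2 := summable_featureSup hγ0 hγ1 h2 σ (by positivity)
  have hsz : Summable fun l => (γ ^ l)⁻¹ * |psum σ m (z (l + 1))| :=
    summable_featureNorm hγ0 hγ1 (z := fun l => z (l + 1)) (L := L) (fun l i => (hz _ _).trans
      (mul_le_mul_of_nonneg_left (pow_le_pow_of_le_one hγ0.le hγ1.le (by omega)) hL)) σ hL m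
  refine le_trans ?_ (add_le_add_left (featureNorm_shift_le hγ0 hγ1 hz σ hL m) _)
  rw [featureNorm, featureNorm, featureSup, featureSup, ← hs1.tsum_add hs2,
    ← hsz.tsum_add (hs1.add hs2)]
  refine (summable_featureNorm hγ0 hγ1 hz' σ hL m).tsum_le_tsum (fun l => ?_)
    (hsz.add (hs1.add hs2))
  rw [← mul_add, ← mul_add, psum_congr σ (h l), psum_add, psum_add]
  refine mul_le_mul_of_nonneg_left ?_ (by positivity)
  refine (abs_add_le _ _).trans (add_le_add_right ((abs_add_le _ _).trans ?_) _)
  exact add_le_add (abs_psum_le_psumSup _ _ _) (abs_psum_le_psumSup _ _ _)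

include hγ0 hγ1 in
theorem pmfExp_featureSup_le {β : Type*} [Fintype β] (hL : 0 ≤ L) (p : Fin N → PMF β)
    (ψ : ℕ → Fin N → β → ℝ) (hψ : ∀ l i x, |ψ l i x| ≤ L * γ ^ (2 * l)) :
    pmfExp (indepProd p) (fun x => featureSup γ σ fun l i => ψ l i (x i) - pmfExp (p i) (ψ l i))
      ≤ 8 * L / (1 - γ) * √N := by
  have h0 : ∀ (x : Fin N → β) l i, |ψ l i (x i) - pmfExp (p i) (ψ l i)| ≤
      2 * L * γ ^ (2 * l) := fun x l i =>
    (abs_sub _ _).trans (by linarith [hψ l i (x i), abs_pmfExp_le (p i) (hψ l i)])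
  simp_rw [featureSup]
  rw [pmfExp_tsum _ fun x => summable_featureSup hγ0 hγ1 (h0 x) σ (by positivity)]
  simp_rw [pmfExp_const_mul]
  rw [div_mul_eq_mul_div]
  refine tsum_le_of_le_pow_two_mul hγ0 hγ1 (fun l => pmfExp_nonneg _ fun x =>
    psumSup_nonneg _ _) fun l => ?_
  refine (pmfExp_psumSup_le σ p (ψ l) (by positivity) (hψ l)).trans_eq ?_
  ring

end FeatureNorm

namespace WCMDP

variable {S A : Type*} [Fintype S] [Fintype A] [DecidableEq S] {K N : ℕ}

/-! ### One step of the ID policy -/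

/-- The reward (`none`) and the costs (`some k`) of the arms. -/
def gain (M : WCMDP S A K N) : Option (Fin K) → Fin N → S → A → ℝ
  | none => M.reward
  | some k => M.cost k

/-- The expected centred gain of arm `i`, `l` steps ahead under its single-armed policy. -/
noncomputable def armFeature [Nonempty A] (M : WCMDP S A K N) (y : Fin N → S → A → ℝ)
    (hy : ∀ i s a, 0 ≤ y i s a) (j : Option (Fin K)) (l : ℕ) (i : Fin N) : S → ℝ :=
  chainFeature (M.inducedChain y i) (stateDist y i) (policyMean y hy i (M.gain j i)) l

/-- The law of the ideal actions in the system state `s`. -/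
noncomputable def idealLaw [Nonempty A] (y : Fin N → S → A → ℝ) (hy : ∀ i s a, 0 ≤ y i s a)
    (s : Fin N → S) : PMF (Fin N → A) :=
  indepProd fun i => singleArmPolicy y hy i (s i)

omit [DecidableEq S] in
theorem pmfExp_stateActionLaw_idPolicy [Nonempty A] (M : WCMDP S A K N) (α : Fin K → ℝ)
    (y : Fin N → S → A → ℝ) (hy : ∀ i s a, 0 ≤ y i s a) (σ : Equiv.Perm (Fin N))
    (s₀ : Fin N → S) (t : ℕ) (F : (Fin N → S) × (Fin N → A) → ℝ) :
    pmfExp (M.stateActionLaw (M.idPolicy α y hy σ) s₀ t) F =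
      pmfExp (M.stateLaw (M.idPolicy α y hy σ) s₀ t) fun s =>
        pmfExp (idealLaw y hy s) fun a => F (s, M.executedAction α σ s a) := by
  have h : M.stateActionLaw (M.idPolicy α y hy σ) s₀ t =
      (M.stateLaw (M.idPolicy α y hy σ) s₀ t).bind fun s =>
        (idealLaw y hy s).map fun a => (s, M.executedAction α σ s a) := by
    rw [stateLaw, PMF.bind_map]
    refine congrArg _ (funext fun hs => ?_)
    exact PMF.map_comp _ _ _
  rw [h, pmfExp_bind]
  simp_rw [pmfExp_map]

omit [Fintype S] [Fintype A] [DecidableEq S] in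
-- Costs are nonnegative, so a prefix that fits the budget contains no earlier violation.
theorem executedAction_eq (M : WCMDP S A K N) {α : Fin K → ℝ} {σ : Equiv.Perm (Fin N)}
    {s : Fin N → S} {a : Fin N → A} {m : ℕ}
    (h : ∀ k, psum σ m (fun i => M.cost k i (s i) (a i)) ≤ α k * N) {i : Fin N}
    (hi : (σ i : ℕ) < m) : M.executedAction α σ s a i = a i := by
  refine if_pos fun q hq k => le_trans ?_ (h k)
  refine Finset.sum_le_sum_of_subset_of_nonneg (fun j hj => ?_) fun j _ _ => M.cost_nonneg k j _ _
  simp only [Finset.mem_filter, Finset.mem_univ, true_and] at hj ⊢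
  exact lt_of_le_of_lt (Fin.le_iff_val_le_val.mp (hj.trans hq)) hi

/-- Bounds for the reward, the costs, the features and the budget slack. -/
structure DriftBounds [Nonempty A] (M : WCMDP S A K N) (α : Fin K → ℝ) (y : Fin N → S → A → ℝ)
    (hy : ∀ i s a, 0 ≤ y i s a) (σ : Equiv.Perm (Fin N)) (G γ L β c₀ : ℝ) : Prop where
  gain_le : ∀ j i s a, |M.gain j i s a| ≤ G
  gain_nonneg : 0 ≤ G
  rate_pos : 0 < γ
  rate_lt_one : γ < 1
  feature_nonneg : 0 < L
  feature_le : ∀ j l i s, |M.armFeature y hy j l i s| ≤ L * γ ^ (2 * l)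
  slack_pos : 0 < β
  const_nonneg : 0 ≤ c₀
  budget_pos : ∀ k, 0 < α k
  slack : ∀ k w, w ≤ N → psum σ (N - w) (M.expCost y k) ≤ α k * N - β * w + c₀

/-! ### The potential and the noise terms -/

section Potential

variable [Nonempty A] (M : WCMDP S A K N) (y : Fin N → S → A → ℝ)
  (hy : ∀ i s a, 0 ≤ y i s a) (σ : Equiv.Perm (Fin N)) (γ β : ℝ)

/-- The norm of the features of the first `m` arms. -/
noncomputable def stateNorm (j : Option (Fin K)) (s : Fin N → S) (m : ℕ) : ℝ :=
  featureNorm γ σ m fun l i => M.armFeature y hy j l i (s i)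

/-- The number of arms that have to be left out for the others to be close to stationarity. -/
noncomputable def potential (s : Fin N → S) : ℕ :=
  -- Quantifying over all `w' ≥ w` makes the bound available at every value from the infimum on.
  sInf {w | ∀ w', w ≤ w' → ∀ j, M.stateNorm y hy σ γ j s (N - w') ≤ β / 2 * w'}

/-- The noise of the costs of the ideal actions. -/
noncomputable def costNoise (s : Fin N → S) (a : Fin N → A) : ℝ :=
  ∑ k, psumSup σ fun i => M.cost k i (s i) (a i) - policyMean y hy i (M.cost k i) (s i)

/-- The noise of the features that is due to the ideal actions. -/
noncomputable def actionNoise (s : Fin N → S) (a : Fin N → A) : ℝ :=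
  ∑ j, featureSup γ σ fun l i => pmfExp (M.trans i (s i) (a i)) (M.armFeature y hy j l i)
    - M.armFeature y hy j (l + 1) i (s i)

/-- The noise of the features that is due to the transitions. -/
noncomputable def transNoise (s : Fin N → S) (a : Fin N → A) (s' : Fin N → S) : ℝ :=
  ∑ j, featureSup γ σ fun l i => M.armFeature y hy j l i (s' i)
    - pmfExp (M.trans i (s i) (a i)) (M.armFeature y hy j l i)

omit [Fintype S] [DecidableEq S] in
theorem costNoise_nonneg (s : Fin N → S) (a : Fin N → A) : 0 ≤ M.costNoise y hy σ s a :=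
  Finset.sum_nonneg fun _ _ => psumSup_nonneg _ _

theorem policyMean_trans_armFeature (j : Option (Fin K)) (l : ℕ) (i : Fin N) (s : S) :
    policyMean y hy i (fun s a => pmfExp (M.trans i s a) (M.armFeature y hy j l i)) s
      = M.armFeature y hy j (l + 1) i s := by
  rw [policyMean_pmfExp_trans, armFeature, mulVec_chainFeature]
  rfl

end Potential

/-! ### Contraction of the potential -/

namespace DriftBounds

variable [Nonempty A] {M : WCMDP S A K N} {α : Fin K → ℝ} {y : Fin N → S → A → ℝ}
  {hy : ∀ i s a, 0 ≤ y i s a} {σ : Equiv.Perm (Fin N)} {G γ L β c₀ : ℝ}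
  (h : M.DriftBounds α y hy σ G γ L β c₀)

include h

/-- From `w' = N` on the prefix is empty. This makes the infimum in `potential` one over a nonempty
set. -/
theorem stateNorm_card_mem (s : Fin N → S) :
    N ∈ {w | ∀ w', w ≤ w' → ∀ j, M.stateNorm y hy σ γ j s (N - w') ≤ β / 2 * w'} := by
  intro w' hw' j
  have := h.slack_pos
  rw [Nat.sub_eq_zero_of_le hw', stateNorm, featureNorm_zero]
  positivity

theorem potential_le_card (s : Fin N → S) : M.potential y hy σ γ β s ≤ N :=
  Nat.sInf_le (h.stateNorm_card_mem s)

theorem stateNorm_le (s : Fin N → S) {w : ℕ} (hw : M.potential y hy σ γ β s ≤ w)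
    (j : Option (Fin K)) : M.stateNorm y hy σ γ j s (N - w) ≤ β / 2 * w :=
  Nat.sInf_mem ⟨N, h.stateNorm_card_mem s⟩ w hw j

/-- The margin gained in one step. -/
theorem stateNorm_le_of_potential_le (s : Fin N → S) {ε : ℝ}
    (hεL : ε * (β / 2 + L / (1 - γ)) ≤ β * (1 - γ) / 4) {w : ℕ}
    (hw : (M.potential y hy σ γ β s : ℝ) ≤ (1 + ε) * w) (j : Option (Fin K)) :
    M.stateNorm y hy σ γ j s (N - w) ≤ (β / 2 + β * (1 - γ) / 4) * w := by
  have hβ := h.slack_pos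
  have hγ := sub_pos.mpr h.rate_lt_one
  set V := M.potential y hy σ γ β s
  rcases le_or_gt V w with hV | hV
  · refine (h.stateNorm_le s hV j).trans ?_
    gcongr
    have : 0 ≤ β * (1 - γ) / 4 := by positivity
    linarith
  -- Here the prefix is longer than `N - V` by `V - w ≤ ε * w` arms, each of which costs at most `L
  -- / (1 - γ)`; `hεL` says that this is affordable.
  · have hVN : V ≤ N := h.potential_le_card s
    have h1 : M.stateNorm y hy σ γ j s (N - w) ≤ M.stateNorm y hy σ γ j s (N - V)
        + L / (1 - γ) * (((N - w : ℕ) : ℝ) - ((N - V : ℕ) : ℝ)) :=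
      featureNorm_le_add h.rate_pos h.rate_lt_one (fun l i => h.feature_le j l i (s i)) σ
        h.feature_nonneg.le (by omega)
    rw [Nat.cast_sub hVN, Nat.cast_sub (by omega)] at h1
    have h2 := h.stateNorm_le s (le_refl V) j
    have hw0 : (0 : ℝ) ≤ w := Nat.cast_nonneg w
    have h3 : L / (1 - γ) * (((N : ℝ) - w) - (N - V)) ≤ L / (1 - γ) * (ε * w) := by
      have : 0 ≤ L / (1 - γ) := div_nonneg h.feature_nonneg.le hγ.le
      exact mul_le_mul_of_nonneg_left (by linarith) this
    have h4 : β / 2 * V ≤ β / 2 * ((1 + ε) * w) := mul_le_mul_of_nonneg_left hw (by positivity)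
    have h5 := mul_le_mul_of_nonneg_right hεL hw0
    linarith

/-- The cost of an ideal action is its noise, plus the feature with `l = 0`, plus the LP cost. The
slack `β * w` pays for the norm and the noise, because `β / 2 + 2 * (β * (1 - γ) / 4) ≤ β`. -/
theorem psum_cost_le (s : Fin N → S) (a : Fin N → A) {w : ℕ}
    (hw : ∀ j, M.stateNorm y hy σ γ j s (N - w) ≤ (β / 2 + β * (1 - γ) / 4) * w)
    (hZ : M.costNoise y hy σ s a + c₀ ≤ β * (1 - γ) / 4 * w) (k : Fin K) :
    psum σ (N - w) (fun i => M.cost k i (s i) (a i)) ≤ α k * N := by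
  rcases le_total w N with hwN | hwN
  · have h0 : ∀ i, M.cost k i (s i) (a i) = (M.cost k i (s i) (a i)
        - policyMean y hy i (M.cost k i) (s i)) + (M.armFeature y hy (some k) 0 i (s i)
        + M.expCost y k i) := fun i => by
      rw [armFeature, chainFeature_zero, gain, sum_stateDist_mul_policyMean, expCost]
      ring
    rw [psum_congr σ fun i _ => h0 i, psum_add, psum_add]
    have h1 := (le_abs_self _).trans (abs_psum_le_psumSup σ (fun i => M.cost k i (s i) (a i)
      - policyMean y hy i (M.cost k i) (s i)) (N - w))
    have h2 : psumSup σ (fun i => M.cost k i (s i) (a i)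
        - policyMean y hy i (M.cost k i) (s i)) ≤ M.costNoise y hy σ s a :=
      Finset.single_le_sum (f := fun k => psumSup σ fun i => M.cost k i (s i) (a i)
        - policyMean y hy i (M.cost k i) (s i)) (fun _ _ => psumSup_nonneg _ _) (Finset.mem_univ k)
    have h3 := (le_abs_self _).trans (abs_psum_le_featureNorm h.rate_pos h.rate_lt_one
      (fun l i => h.feature_le (some k) l i (s i)) σ h.feature_nonneg.le (N - w))
    have h4 := hw (some k)
    rw [stateNorm] at h4
    have h5 := h.slack k w hwN
    have h6 : 0 ≤ β * γ * w := mul_nonneg (mul_pos h.slack_pos h.rate_pos).le (Nat.cast_nonneg w)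
    linarith
  · rw [Nat.sub_eq_zero_of_le hwN, psum_zero]
    exact mul_nonneg (h.budget_pos k).le (Nat.cast_nonneg N)

theorem abs_pmfExp_trans_armFeature_le (j : Option (Fin K)) (l : ℕ) (i : Fin N) (s : S) (a : A) :
    |pmfExp (M.trans i s a) (M.armFeature y hy j l i)| ≤ L * γ ^ (2 * l) :=
  abs_pmfExp_le _ (h.feature_le j l i)

/-- Under an ideal action the mean of feature `l` at the next state is feature `l + 1` at the
present one. Transition noise is centred given the executed actions `b`, action noise given the law
of the ideal actions `a`; the two fit together where `b` and `a` agree. -/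
theorem stateNorm_next_le (s : Fin N → S) (a b : Fin N → A) (s' : Fin N → S) {m : ℕ}
    (hb : ∀ i, (σ i : ℕ) < m → b i = a i) (j : Option (Fin K)) :
    M.stateNorm y hy σ γ j s' m ≤ γ * M.stateNorm y hy σ γ j s m
      + (M.transNoise y hy σ γ s b s' + M.actionNoise y hy σ γ s a) := by
  have hL := h.feature_nonneg
  have hγ0 := h.rate_pos
  have hshift : ∀ l i, |M.armFeature y hy j (l + 1) i (s i)| ≤ L * γ ^ (2 * l) := fun l i =>
    (h.feature_le j _ i _).trans (mul_le_mul_of_nonneg_left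
      (pow_le_pow_of_le_one hγ0.le h.rate_lt_one.le (by omega)) hL.le)
  have h1 := featureNorm_le_of_noise hγ0 h.rate_lt_one (fun l i => h.feature_le j l i (s i)) σ
    hL.le m (z' := fun l i => M.armFeature y hy j l i (s' i))
    (n₁ := fun l i => M.armFeature y hy j l i (s' i)
      - pmfExp (M.trans i (s i) (b i)) (M.armFeature y hy j l i))
    (n₂ := fun l i => pmfExp (M.trans i (s i) (a i)) (M.armFeature y hy j l i)
      - M.armFeature y hy j (l + 1) i (s i))
    (fun l i => (abs_sub _ _).trans (by
      linarith [h.feature_le j l i (s' i), h.abs_pmfExp_trans_armFeature_le j l i (s i) (b i)]))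
    (fun l i => (abs_sub _ _).trans (by
      linarith [hshift l i, h.abs_pmfExp_trans_armFeature_le j l i (s i) (a i)]))
    (fun l i => h.feature_le j l i (s' i))
    (fun l i hi => by
      rw [hb i hi]
      ring)
  refine h1.trans (add_le_add_right (add_le_add ?_ ?_) _)
  · exact Finset.single_le_sum (f := fun j => featureSup γ σ fun l i =>
      M.armFeature y hy j l i (s' i) - pmfExp (M.trans i (s i) (b i)) (M.armFeature y hy j l i))
      (fun _ _ => featureSup_nonneg hγ0 _) (Finset.mem_univ j)
  · exact Finset.single_le_sum (f := fun j => featureSup γ σ fun l i =>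
      pmfExp (M.trans i (s i) (a i)) (M.armFeature y hy j l i)
        - M.armFeature y hy j (l + 1) i (s i))
      (fun _ _ => featureSup_nonneg hγ0 _) (Finset.mem_univ j)

theorem actionNoise_nonneg (s : Fin N → S) (a : Fin N → A) : 0 ≤ M.actionNoise y hy σ γ s a :=
  Finset.sum_nonneg fun _ _ => featureSup_nonneg h.rate_pos _

theorem transNoise_nonneg (s : Fin N → S) (a : Fin N → A) (s' : Fin N → S) :
    0 ≤ M.transNoise y hy σ γ s a s' :=
  Finset.sum_nonneg fun _ _ => featureSup_nonneg h.rate_pos _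

theorem executedAction_eq_of_le (s : Fin N → S) (a : Fin N → A) {ε : ℝ} (hε : 0 ≤ ε)
    (hεL : ε * (β / 2 + L / (1 - γ)) ≤ β * (1 - γ) / 4) {w : ℕ}
    (hw : (M.potential y hy σ γ β s : ℝ) / (1 + ε)
      + (M.costNoise y hy σ s a + c₀) / (β * (1 - γ) / 4) ≤ w) {i : Fin N}
    (hi : (σ i : ℕ) < N - w) : M.executedAction α σ s a i = a i := by
  have hκ : 0 < β * (1 - γ) / 4 :=
    div_pos (mul_pos h.slack_pos (sub_pos.mpr h.rate_lt_one)) four_pos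
  have h1 : 0 ≤ (M.potential y hy σ γ β s : ℝ) / (1 + ε) := by positivity
  have h2 : 0 ≤ (M.costNoise y hy σ s a + c₀) / (β * (1 - γ) / 4) :=
    div_nonneg (add_nonneg (M.costNoise_nonneg y hy σ s a) h.const_nonneg) hκ.le
  refine M.executedAction_eq (h.psum_cost_le s a
    (h.stateNorm_le_of_potential_le s hεL ?_) ?_) hi
  · rw [← div_le_iff₀' (by positivity)]
    linarith
  · rw [← div_le_iff₀' hκ]
    linarith

/-- The potential contracts in one step, up to noise. -/
theorem potential_next_le (s : Fin N → S) (a : Fin N → A) (s' : Fin N → S) {ε : ℝ} (hε : 0 ≤ ε)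
    (hεL : ε * (β / 2 + L / (1 - γ)) ≤ β * (1 - γ) / 4) :
    (M.potential y hy σ γ β s' : ℝ) ≤ (M.potential y hy σ γ β s : ℝ) / (1 + ε)
      + (M.costNoise y hy σ s a + M.actionNoise y hy σ γ s a
        + M.transNoise y hy σ γ s (M.executedAction α σ s a) s' + c₀) / (β * (1 - γ) / 4) + 1 := by
  have hγ := sub_pos.mpr h.rate_lt_one
  have hκ : 0 < β * (1 - γ) / 4 := div_pos (mul_pos h.slack_pos hγ) four_pos
  have n1 := M.costNoise_nonneg y hy σ s a
  have n2 := h.actionNoise_nonneg s a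
  have n3 := h.transNoise_nonneg s (M.executedAction α σ s a) s'
  have n4 := h.const_nonneg
  set Z := M.costNoise y hy σ s a + M.actionNoise y hy σ γ s a
        + M.transNoise y hy σ γ s (M.executedAction α σ s a) s' + c₀ with hZ
  set W := (M.potential y hy σ γ β s : ℝ) / (1 + ε) + Z / (β * (1 - γ) / 4) with hW
  have h1 : 0 ≤ (M.potential y hy σ γ β s : ℝ) / (1 + ε) := by positivity
  have h2 : 0 ≤ Z / (β * (1 - γ) / 4) := div_nonneg (by linarith) hκ.le
  have hle : M.potential y hy σ γ β s' ≤ ⌈W⌉₊ := by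
    refine Nat.sInf_le fun w hw j => ?_
    have hWw : W ≤ w := (Nat.le_ceil W).trans (by exact_mod_cast hw)
    have hfollow : ∀ i, (σ i : ℕ) < N - w → M.executedAction α σ s a i = a i := fun i hi => by
      refine h.executedAction_eq_of_le s a hε hεL (le_trans ?_ hWw) hi
      refine add_le_add_right (div_le_div_of_nonneg_right (by linarith) hκ.le) _
    have h3 := h.stateNorm_le_of_potential_le s hεL (w := w) (by
      rw [← div_le_iff₀' (by positivity)]
      linarith) j
    have h4 := h.stateNorm_next_le s a _ s' hfollow j
    have h5 : Z ≤ β * (1 - γ) / 4 * w := by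
      rw [← div_le_iff₀' hκ]
      linarith
    have h6 := mul_le_mul_of_nonneg_left h3 h.rate_pos.le
    -- With `κ = β * (1 - γ) / 4`, the required bound holds because `γ * (β / 2 + κ) + κ = β / 2 - κ
    -- * (1 - γ)`.
    have h7 : 0 ≤ β * (1 - γ) / 4 * (1 - γ) * w :=
      mul_nonneg (mul_pos hκ hγ).le (Nat.cast_nonneg w)
    linarith
  calc (M.potential y hy σ γ β s' : ℝ) ≤ ⌈W⌉₊ := by exact_mod_cast hle
    _ ≤ W + 1 := (Nat.ceil_lt_add_one (by linarith)).le

end DriftBounds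

end WCMDP

namespace WCMDP

variable {S A : Type*} [Fintype S] [Fintype A] [DecidableEq S] {K N : ℕ}

namespace DriftBounds

variable [Nonempty A] {M : WCMDP S A K N} {α : Fin K → ℝ} {y : Fin N → S → A → ℝ}
  {hy : ∀ i s a, 0 ≤ y i s a} {σ : Equiv.Perm (Fin N)} {G γ L β c₀ : ℝ}
  (h : M.DriftBounds α y hy σ G γ L β c₀)

include h

/-! ### Expected noise -/

theorem pmfExp_costNoise_le (s : Fin N → S) :
    pmfExp (idealLaw y hy s) (M.costNoise y hy σ s) ≤ K * (8 * G) * √N := by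
  unfold costNoise idealLaw
  rw [pmfExp_sum]
  calc _ ≤ ∑ _k : Fin K, 8 * G * √N := Finset.sum_le_sum fun k _ =>
        pmfExp_psumSup_le σ (fun i => singleArmPolicy y hy i (s i)) (fun i => M.cost k i (s i))
          h.gain_nonneg fun i a => h.gain_le (some k) i (s i) a
    _ = K * (8 * G) * √N := by simp [mul_assoc]

theorem pmfExp_actionNoise_le (s : Fin N → S) :
    pmfExp (idealLaw y hy s) (M.actionNoise y hy σ γ s) ≤ (K + 1) * (8 * L / (1 - γ)) * √N := by
  unfold actionNoise idealLaw
  rw [pmfExp_sum]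
  calc _ ≤ ∑ _j : Option (Fin K), 8 * L / (1 - γ) * √N := Finset.sum_le_sum fun j _ => by
        have h1 := pmfExp_featureSup_le h.rate_pos h.rate_lt_one σ h.feature_nonneg.le
          (fun i => singleArmPolicy y hy i (s i))
          (fun l i a => pmfExp (M.trans i (s i) a) (M.armFeature y hy j l i))
          fun l i a => h.abs_pmfExp_trans_armFeature_le j l i (s i) a
        have h2 : ∀ l i, pmfExp (singleArmPolicy y hy i (s i))
            (fun a => pmfExp (M.trans i (s i) a) (M.armFeature y hy j l i))
            = M.armFeature y hy j (l + 1) i (s i) := fun l i =>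
          M.policyMean_trans_armFeature y hy j l i (s i)
        simp_rw [h2] at h1
        exact h1
    _ = (K + 1) * (8 * L / (1 - γ)) * √N := by simp [mul_assoc]

theorem pmfExp_transNoise_le (s : Fin N → S) (a : Fin N → A) :
    pmfExp (M.sysTrans s a) (M.transNoise y hy σ γ s a) ≤ (K + 1) * (8 * L / (1 - γ)) * √N := by
  unfold transNoise sysTrans
  rw [pmfExp_sum]
  calc _ ≤ ∑ _j : Option (Fin K), 8 * L / (1 - γ) * √N := Finset.sum_le_sum fun j _ =>
        pmfExp_featureSup_le h.rate_pos h.rate_lt_one σ h.feature_nonneg.le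
          (fun i => M.trans i (s i) (a i)) (fun l i => M.armFeature y hy j l i)
          fun l i s' => h.feature_le j l i s'
    _ = (K + 1) * (8 * L / (1 - γ)) * √N := by simp [mul_assoc]

end DriftBounds

/-- The coefficient of `√N` in the expected noise of one step. -/
noncomputable def noiseConst (K : ℕ) (G γ L β c₀ : ℝ) : ℝ :=
  (K * (8 * G) + (K + 1) * (8 * L / (1 - γ)) + (K + 1) * (8 * L / (1 - γ)) + c₀)
    / (β * (1 - γ) / 4) + 1

namespace DriftBounds

variable [Nonempty A] {M : WCMDP S A K N} {α : Fin K → ℝ} {y : Fin N → S → A → ℝ}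
  {hy : ∀ i s a, 0 ≤ y i s a} {σ : Equiv.Perm (Fin N)} {G γ L β c₀ : ℝ}
  (h : M.DriftBounds α y hy σ G γ L β c₀) {ε : ℝ} (hε : 0 ≤ ε)
  (hεL : ε * (β / 2 + L / (1 - γ)) ≤ β * (1 - γ) / 4)

include h

theorem noiseConst_nonneg : 0 ≤ noiseConst K G γ L β c₀ := by
  have h1 := sub_pos.mpr h.rate_lt_one
  have h2 := h.gain_nonneg
  have h3 := h.feature_nonneg
  have h4 := h.const_nonneg
  have h5 := h.slack_pos
  unfold noiseConst
  positivity

/-- The noise coefficient absorbs the additive constants. -/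
theorem noise_le_noiseConst (hN : 0 < N) {z : ℝ}
    (hz : z ≤ (K * (8 * G) + (K + 1) * (8 * L / (1 - γ)) + (K + 1) * (8 * L / (1 - γ))) * √N) :
    (z + c₀) / (β * (1 - γ) / 4) + 1 ≤ noiseConst K G γ L β c₀ * √N := by
  have hκ : 0 < β * (1 - γ) / 4 :=
    div_pos (mul_pos h.slack_pos (sub_pos.mpr h.rate_lt_one)) four_pos
  -- This lets `√N` absorb both `c₀` and the rounding error `1`.
  have h1 : 1 ≤ √(N : ℝ) := Real.one_le_sqrt.mpr (by exact_mod_cast hN)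
  have h2 := mul_le_mul_of_nonneg_left h1 h.const_nonneg
  rw [noiseConst, add_mul, one_mul, div_mul_eq_mul_div, add_mul _ c₀]
  exact add_le_add (div_le_div_of_nonneg_right (by linarith) hκ.le) h1

include hε hεL

/-- The transition noise is averaged first, with the ideal actions fixed, since they determine the
executed ones; the noise of the actions is averaged afterwards. -/
theorem pmfExp_potential_next_le (hN : 0 < N) (s : Fin N → S) :
    pmfExp (idealLaw y hy s) (fun a => pmfExp (M.sysTrans s (M.executedAction α σ s a))
      fun s' => (M.potential y hy σ γ β s' : ℝ)) ≤
      (M.potential y hy σ γ β s : ℝ) / (1 + ε) + noiseConst K G γ L β c₀ * √N := by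
  have hκ : 0 < β * (1 - γ) / 4 :=
    div_pos (mul_pos h.slack_pos (sub_pos.mpr h.rate_lt_one)) four_pos
  set κ := β * (1 - γ) / 4 with hκdef
  set B := (K + 1) * (8 * L / (1 - γ)) * √N with hB
  have h1 : ∀ a, pmfExp (M.sysTrans s (M.executedAction α σ s a))
      (fun s' => (M.potential y hy σ γ β s' : ℝ)) ≤
      ((M.potential y hy σ γ β s : ℝ) / (1 + ε) + (B + c₀) / κ + 1)
        + κ⁻¹ * (M.costNoise y hy σ s a + M.actionNoise y hy σ γ s a) := fun a => by
    calc _ ≤ pmfExp (M.sysTrans s (M.executedAction α σ s a)) (fun s' =>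
          ((M.potential y hy σ γ β s : ℝ) / (1 + ε) + (M.costNoise y hy σ s a
            + M.actionNoise y hy σ γ s a + c₀) / κ + 1)
            + κ⁻¹ * M.transNoise y hy σ γ s (M.executedAction α σ s a) s') :=
          pmfExp_mono _ fun s' => (h.potential_next_le s a s' hε hεL).trans_eq (by ring)
      _ ≤ ((M.potential y hy σ γ β s : ℝ) / (1 + ε) + (M.costNoise y hy σ s a
            + M.actionNoise y hy σ γ s a + c₀) / κ + 1) + κ⁻¹ * B := by
          rw [pmfExp_add, pmfExp_const, pmfExp_const_mul]
          exact add_le_add_right (mul_le_mul_of_nonneg_left (h.pmfExp_transNoise_le s _)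
            (inv_pos.mpr hκ).le) _
      _ = _ := by ring
  refine (pmfExp_mono _ h1).trans ?_
  rw [pmfExp_add, pmfExp_const, pmfExp_const_mul, pmfExp_add]
  have h2 := h.noise_le_noiseConst hN (z := pmfExp (idealLaw y hy s) (M.costNoise y hy σ s)
    + pmfExp (idealLaw y hy s) (M.actionNoise y hy σ γ s) + B) (by
      have := h.pmfExp_costNoise_le s
      have := h.pmfExp_actionNoise_le s
      rw [add_mul, add_mul]
      linarith)
  rw [← hκdef] at h2
  refine le_trans (le_of_eq ?_) (add_le_add_right h2 _)
  ring

/-- The one-step reward of the ID policy. -/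
theorem le_pmfExp_reward (hN : 0 < N) (s : Fin N → S) :
    N * M.lpObjective y - ((β / 2 + L + 2 * G) * M.potential y hy σ γ β s
      + 2 * G * (noiseConst K G γ L β c₀ * √N)) ≤
      pmfExp (idealLaw y hy s) fun a => ∑ i, M.reward i (s i) (M.executedAction α σ s a i) := by
  have hκ : 0 < β * (1 - γ) / 4 :=
    div_pos (mul_pos h.slack_pos (sub_pos.mpr h.rate_lt_one)) four_pos
  have hG := h.gain_nonneg
  set κ := β * (1 - γ) / 4 with hκdef
  set V := M.potential y hy σ γ β s with hV
  have hr : ∀ i s a, |M.reward i s a| ≤ G := h.gain_le none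
  have h1 : ∀ a, ∑ i, M.reward i (s i) (a i) - (2 * G * ((V : ℝ) + c₀ / κ + 1)
      + 2 * G * κ⁻¹ * M.costNoise y hy σ s a) ≤
      ∑ i, M.reward i (s i) (M.executedAction α σ s a i) := fun a => by
    have n1 := M.costNoise_nonneg y hy σ s a
    have n2 := h.const_nonneg
    -- At most the last `⌈W⌉₊` arms deviate from their ideal actions, and each loses at most `2 *
    -- G`.
    set W := (V : ℝ) / (1 + ε) + (M.costNoise y hy σ s a + c₀) / κ with hW
    have hWV : W ≤ V + (M.costNoise y hy σ s a + c₀) / κ :=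
      add_le_add_left (div_le_self (Nat.cast_nonneg V) (by linarith)) _
    have hW0 : 0 ≤ W := by positivity
    set z : Fin N → ℝ := fun i => M.reward i (s i) (a i)
      - M.reward i (s i) (M.executedAction α σ s a i) with hz
    have h2 : psum σ (N - ⌈W⌉₊) z = 0 := Finset.sum_eq_zero fun i hi => by
      simp only [hz]
      rw [h.executedAction_eq_of_le s a hε hεL (Nat.le_ceil W) (Finset.mem_filter.mp hi).2,
        sub_self]
    have h3 := abs_psum_sub_psum_le σ (z := z) (b := 2 * G) (fun i => (abs_sub _ _).trans (by
      linarith [hr i (s i) (a i), hr i (s i) (M.executedAction α σ s a i)])) (by positivity)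
      (Nat.sub_le N ⌈W⌉₊)
    rw [h2, sub_zero, psum_card, hz, Finset.sum_sub_distrib] at h3
    have h4 : (N : ℝ) ≤ ((N - ⌈W⌉₊ : ℕ) : ℝ) + ⌈W⌉₊ := by exact_mod_cast le_tsub_add
    have h5 := (Nat.ceil_lt_add_one hW0).le
    have h6 : 2 * G * ((N : ℝ) - (N - ⌈W⌉₊ : ℕ)) ≤
        2 * G * ((V : ℝ) + (M.costNoise y hy σ s a + c₀) / κ + 1) :=
      mul_le_mul_of_nonneg_left (by linarith) (by positivity)
    have h7 := (le_abs_self _).trans (h3.trans h6)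
    have h8 : 2 * G * ((V : ℝ) + (M.costNoise y hy σ s a + c₀) / κ + 1) =
        2 * G * ((V : ℝ) + c₀ / κ + 1) + 2 * G * κ⁻¹ * M.costNoise y hy σ s a := by ring
    linarith
  refine le_trans ?_ (pmfExp_mono _ h1)
  rw [pmfExp_sub, pmfExp_add, pmfExp_const, pmfExp_const_mul, pmfExp_sum]
  have h9 : ∀ i, pmfExp (idealLaw y hy s) (fun a => M.reward i (s i) (a i)) =
      M.armFeature y hy none 0 i (s i) + ∑ s, ∑ a, y i s a * M.reward i s a := fun i => by
    rw [idealLaw, pmfExp_indepProd_coord (fun i => singleArmPolicy y hy i (s i)) i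
      (M.reward i (s i)), armFeature, chainFeature_zero, sum_stateDist_mul_policyMean, gain,
      sub_add_cancel, policyMean]
  simp_rw [h9, Finset.sum_add_distrib]
  have h10 : ∑ i, ∑ s, ∑ a, y i s a * M.reward i s a = N * M.lpObjective y := by
    have : (N : ℝ) ≠ 0 := by exact_mod_cast hN.ne'
    rw [lpObjective]
    field_simp
  rw [h10]
  -- The ideal reward differs from the LP value by the reward features: the norm controls their sum
  -- over the first `N - V` arms by `β / 2 * V`, and the last `V` arms contribute at most `L` each.
  have hf0 : ∀ i, |M.armFeature y hy none 0 i (s i)| ≤ L := fun i => by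
    simpa using h.feature_le none 0 i (s i)
  have h11 := abs_psum_sub_psum_le σ hf0 h.feature_nonneg.le (Nat.sub_le N V)
  rw [psum_card, Nat.cast_sub (h.potential_le_card s), sub_sub_cancel] at h11
  have h12 := (abs_psum_le_featureNorm h.rate_pos h.rate_lt_one
    (fun l i => h.feature_le none l i (s i)) σ h.feature_nonneg.le (N - V)).trans
    (h.stateNorm_le s le_rfl none)
  have h13 := (abs_le.mp h11).1
  have h14 := (abs_le.mp h12).1
  have h15 := h.noise_le_noiseConst hN (z := pmfExp (idealLaw y hy s) (M.costNoise y hy σ s)) (by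
    have h3 := sub_pos.mpr h.rate_lt_one
    have h4 : 0 ≤ (K + 1) * (8 * L / (1 - γ)) * √N := by
      have := h.feature_nonneg
      positivity
    have := h.pmfExp_costNoise_le s
    rw [add_mul, add_mul]
    linarith)
  rw [← hκdef] at h15
  have h16 := mul_le_mul_of_nonneg_left h15 (show 0 ≤ 2 * G by positivity)
  have h17 : 2 * G * ((pmfExp (idealLaw y hy s) (M.costNoise y hy σ s) + c₀) / κ + 1) =
      2 * G * (c₀ / κ + 1) + 2 * G * κ⁻¹ * pmfExp (idealLaw y hy s) (M.costNoise y hy σ s) := by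
    ring
  linarith

/-! ### The trajectory of the ID policy -/

/-- The one-step contraction is iterated from the trivial bound `N`, valid in every initial state.
-/
theorem pmfExp_potential_le (hN : 0 < N) (s₀ : Fin N → S) (t : ℕ) :
    pmfExp (M.stateLaw (M.idPolicy α y hy σ) s₀ t) (fun s => (M.potential y hy σ γ β s : ℝ)) ≤
      (1 / (1 + ε)) ^ t * N
        + (∑ k ∈ Finset.range t, (1 / (1 + ε)) ^ k) * (noiseConst K G γ L β c₀ * √N) := by
  induction t with
  | zero =>
    simp only [pow_zero, one_mul, Finset.range_zero, Finset.sum_empty, zero_mul, add_zero]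
    rw [← pmfExp_const (M.stateLaw (M.idPolicy α y hy σ) s₀ 0) (N : ℝ)]
    exact pmfExp_mono _ fun s => by exact_mod_cast h.potential_le_card s
  | succ t ih =>
    rw [pmfExp_stateLaw_succ, pmfExp_stateActionLaw_idPolicy]
    refine (pmfExp_mono _ fun s => h.pmfExp_potential_next_le hε hεL hN s).trans ?_
    have h1 : ∀ s, (M.potential y hy σ γ β s : ℝ) / (1 + ε)
        = 1 / (1 + ε) * M.potential y hy σ γ β s := fun s => by ring
    simp_rw [h1]
    rw [pmfExp_add, pmfExp_const_mul, pmfExp_const, Finset.sum_range_succ', pow_zero]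
    have h2 := mul_le_mul_of_nonneg_left ih (show 0 ≤ 1 / (1 + ε) by positivity)
    simp_rw [pow_succ, ← Finset.sum_mul]
    linarith

theorem lpObjective_sub_sum_expReward_le (hN : 0 < N) (s₀ : Fin N → S) (t : ℕ) :
    N * M.lpObjective y - ∑ i, M.expReward (M.idPolicy α y hy σ) s₀ t i ≤
      (β / 2 + L + 2 * G) *
        pmfExp (M.stateLaw (M.idPolicy α y hy σ) s₀ t) (fun s => (M.potential y hy σ γ β s : ℝ))
      + 2 * G * (noiseConst K G γ L β c₀ * √N) := by
  have h1 : ∑ i, M.expReward (M.idPolicy α y hy σ) s₀ t i =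
      pmfExp (M.stateLaw (M.idPolicy α y hy σ) s₀ t) fun s =>
        pmfExp (idealLaw y hy s) fun a =>
          ∑ i, M.reward i (s i) (M.executedAction α σ s a i) := by
    rw [← pmfExp_stateActionLaw_idPolicy M α y hy σ s₀ t
      (fun x => ∑ i, M.reward i (x.1 i) (x.2 i)), pmfExp_sum]
    rfl
  have h2 := pmfExp_mono (M.stateLaw (M.idPolicy α y hy σ) s₀ t)
    fun s => h.le_pmfExp_reward hε hεL hN s
  rw [pmfExp_sub, pmfExp_const, pmfExp_add, pmfExp_const_mul, pmfExp_const] at h2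
  rw [h1]
  linarith

/-- The initial transient costs `O(N)` in total over all times, and the noise costs `O(√N)` per
step. Division by `T * N` gives the two error terms. -/
theorem lpObjective_sub_avgReward_le (hε' : 0 < ε) (hN : 0 < N) (s₀ : Fin N → S) {T : ℕ}
    (hT : 0 < T) :
    M.lpObjective y - M.avgReward (M.idPolicy α y hy σ) s₀ T ≤
      ((β / 2 + L + 2 * G) * ((1 + ε) / ε) + 2 * G) * noiseConst K G γ L β c₀ / √N
        + (β / 2 + L + 2 * G) * ((1 + ε) / ε) / T := by
  set θ := 1 / (1 + ε) with hθ
  set D := β / 2 + L + 2 * G with hD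
  set B := noiseConst K G γ L β c₀ with hB
  have hD0 : 0 ≤ D := by
    have h1 := h.slack_pos
    have h2 := h.feature_nonneg
    have h3 := h.gain_nonneg
    positivity
  have hB0 : 0 ≤ B := h.noiseConst_nonneg
  have hθ0 : 0 ≤ θ := by positivity
  have hθ1 : θ < 1 := by
    rw [hθ, div_lt_one (by positivity)]
    linarith
  have hgeo : ∀ t, ∑ k ∈ Finset.range t, θ ^ k ≤ (1 + ε) / ε := fun t => by
    have h1 : (1 - θ)⁻¹ = (1 + ε) / ε := by
      rw [hθ, one_sub_div (by positivity), add_sub_cancel_left, inv_div]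
    rw [← h1, ← tsum_geometric_of_lt_one hθ0 hθ1]
    exact (summable_geometric_of_lt_one hθ0 hθ1).sum_le_tsum _ fun k _ => by positivity
  have hstep : ∀ t, N * M.lpObjective y - ∑ i, M.expReward (M.idPolicy α y hy σ) s₀ t i ≤
      D * N * θ ^ t + (D * ((1 + ε) / ε) + 2 * G) * (B * √N) := fun t => by
    have h1 := h.lpObjective_sub_sum_expReward_le hε hεL hN s₀ t
    have h2 := (h.pmfExp_potential_le hε hεL hN s₀ t).trans (add_le_add_right
      (mul_le_mul_of_nonneg_right (hgeo t) (mul_nonneg hB0 (Real.sqrt_nonneg N))) _)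
    have h3 := mul_le_mul_of_nonneg_left h2 hD0
    rw [← hD, ← hB] at h1
    rw [← hθ] at h3
    linarith
  have hsum : ∑ t ∈ Finset.range T,
      (N * M.lpObjective y - ∑ i, M.expReward (M.idPolicy α y hy σ) s₀ t i) ≤
      D * N * ((1 + ε) / ε) + T * ((D * ((1 + ε) / ε) + 2 * G) * (B * √N)) := by
    refine (Finset.sum_le_sum fun t _ => hstep t).trans ?_
    rw [Finset.sum_add_distrib, ← Finset.mul_sum, Finset.sum_const, Finset.card_range,
      nsmul_eq_mul]
    exact add_le_add_left (mul_le_mul_of_nonneg_left (hgeo T) (by positivity)) _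
  rw [Finset.sum_sub_distrib, Finset.sum_const, Finset.card_range, nsmul_eq_mul] at hsum
  have hN' : (0 : ℝ) < N := by exact_mod_cast hN
  have hT' : (0 : ℝ) < T := by exact_mod_cast hT
  have hfin := mul_le_mul_of_nonneg_left hsum (show 0 ≤ 1 / ((T : ℝ) * N) by positivity)
  have hl : M.lpObjective y - M.avgReward (M.idPolicy α y hy σ) s₀ T = 1 / ((T : ℝ) * N) *
      (T * (N * M.lpObjective y) - ∑ t ∈ Finset.range T,
        ∑ i, M.expReward (M.idPolicy α y hy σ) s₀ t i) := by
    rw [avgReward, mul_sub]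
    congr 1
    field_simp
  rw [hl]
  refine hfin.trans (le_of_eq ?_)
  have hs : √(N : ℝ) * √N = N := Real.mul_self_sqrt hN'.le
  have hs0 : √(N : ℝ) ≠ 0 := (Real.sqrt_pos.mpr hN').ne'
  have hs1 : √(N : ℝ) / N = 1 / √N := by
    rw [div_eq_div_iff hN'.ne' hs0, hs, one_mul]
  calc 1 / ((T : ℝ) * N) * (D * N * ((1 + ε) / ε)
        + T * ((D * ((1 + ε) / ε) + 2 * G) * (B * √N)))
      = D * ((1 + ε) / ε) / T * (N / N) + (D * ((1 + ε) / ε) + 2 * G) * B * (√N / N) * (T / T) := by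
        ring
    _ = _ := by
        rw [hs1, div_self hN'.ne', div_self hT'.ne']
        ring

end DriftBounds

end WCMDP

/-! ### Choice of the constants and conclusion -/

theorem proposition1 {K : ℕ} (hK : 0 < K) (α : Fin K → ℝ) (hα : ∀ k, 0 < α k)
    (rmax cmax τ : ℝ) (hτ : 0 < τ) :
    ∃ C_ID C_finite : ℝ, 0 < C_ID ∧ 0 < C_finite ∧
      ∀ (S : Type u) (A : Type v) [Fintype S] [DecidableEq S] [Fintype A]
        (N : ℕ) (_ : 0 < N) (M : WCMDP S A K N)
        (_ : ∀ i s a, |M.reward i s a| ≤ rmax)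
        (_ : ∀ k i s a, M.cost k i s a ≤ cmax)
        (y : Fin N → S → A → ℝ) (hy : M.IsLPOptimal α y)
        (_ : ∀ i, ChainUnichain (M.inducedChain y i) ∧ ChainAperiodic (M.inducedChain y i))
        (_ : ∀ i, ((chainMixingTime (M.inducedChain y i) (WCMDP.stateDist y i) : ℕ∞) : ℝ≥0∞)
          ≤ ENNReal.ofReal τ)
        (σ : Equiv.Perm (Fin N)) (_ : M.IsReassignment α cmax y σ)
        (s₀ : Fin N → S) (T : ℕ) (_ : 1 ≤ T),
        M.optValue α s₀ - M.avgReward (M.idPolicy α y hy.feasible.nonneg σ) s₀ T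
          ≤ C_ID / √(N : ℝ) + C_finite / (T : ℝ) := by
  -- One bound for reward and costs, positive whatever the signs of `rmax` and `cmax`.
  set G := |rmax| + |cmax| + 1 with hG
  have hG0 : 0 < G := by positivity
  have hn0 : 0 < ⌈τ⌉₊ := Nat.ceil_pos.mpr hτ
  have hn0' : (0 : ℝ) < ⌈τ⌉₊ := by exact_mod_cast hn0
  -- The square root of the decay per step that mixing provides; the mixing times, being integers or
  -- infinite, are compared with `⌈τ⌉₊`.
  set γ := Real.exp (-1 / (2 * (⌈τ⌉₊ : ℝ))) with hγ
  have hγ0 : 0 < γ := Real.exp_pos _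
  have hγ1 : γ < 1 := Real.exp_lt_one_iff.mpr (div_neg_of_neg_of_pos (by norm_num) (by positivity))
  have hγ2 := sub_pos.mpr hγ1
  set L := 2 * G * Real.exp 1 with hL
  have hL0 : 0 < L := by positivity
  set β := slackRate α cmax with hβ
  have hβ0 : 0 < β := slackRate_pos hK hα cmax
  set c₀ := 2 * reassignThreshold α with hc₀
  have hc0 : 0 < c₀ := mul_pos two_pos (reassignThreshold_pos hK hα)
  -- The largest `ε` for which the enlarged prefix stays within the margin `β * (1 - γ) / 4`.
  set ε := β * (1 - γ) / 4 / (β / 2 + L / (1 - γ)) with hε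
  have hε0 : 0 < ε := by positivity
  have hεL : ε * (β / 2 + L / (1 - γ)) ≤ β * (1 - γ) / 4 :=
    (div_mul_cancel₀ _ (by positivity)).le
  have hB0 : 0 < WCMDP.noiseConst K G γ L β c₀ := by
    unfold WCMDP.noiseConst
    positivity
  refine ⟨((β / 2 + L + 2 * G) * ((1 + ε) / ε) + 2 * G) * WCMDP.noiseConst K G γ L β c₀,
    (β / 2 + L + 2 * G) * ((1 + ε) / ε), by positivity, by positivity, ?_⟩
  intro S A _ _ _ N hN M hr hc y hy _ hmix σ hσ s₀ T hT
  have : Nonempty A := ⟨M.idle⟩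
  have hgain : ∀ j i s a, |M.gain j i s a| ≤ G := by
    rintro (_ | k) i s a
    · exact (hr i s a).trans (by linarith [le_abs_self rmax, abs_nonneg cmax])
    · refine (abs_of_nonneg (M.cost_nonneg k i s a)).trans_le ((hc k i s a).trans ?_)
      linarith [le_abs_self cmax, abs_nonneg rmax]
  have hmix' : ∀ i, chainMixingTime (M.inducedChain y i) (WCMDP.stateDist y i) ≤ ⌈τ⌉₊ :=
    fun i => by
      have h1 : ENNReal.ofReal τ ≤ (((⌈τ⌉₊ : ℕ∞)) : ℝ≥0∞) := by
        rw [ENat.toENNReal_coe, ← ENNReal.ofReal_natCast]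
        exact ENNReal.ofReal_le_ofReal (Nat.le_ceil τ)
      exact ENat.toENNReal_le.mp ((hmix i).trans h1)
  have hdrift : M.DriftBounds α y hy.feasible.nonneg σ G γ L β c₀ :=
    { gain_le := hgain
      gain_nonneg := hG0.le
      rate_pos := hγ0
      rate_lt_one := hγ1
      feature_nonneg := hL0
      feature_le := fun j l i s => (hy.feasible.isStationaryDist i).abs_chainFeature_le
        (fun s => abs_pmfExp_le _ (hgain j i s)) hn0 (hmix' i) l s
      slack_pos := hβ0
      const_nonneg := hc0.le
      budget_pos := hα
      slack := fun k w hw => WCMDP.psum_expCost_le hN hα hc hy.feasible hσ k hw }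
  have h1 := hdrift.lpObjective_sub_avgReward_le hε0.le hεL hε0 hN s₀ hT
  have h2 := M.optValue_le_lpObjective hr hN hα hy s₀
  linarith
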